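/- Let $\mathbb{R}^5_1$ be $\mathbb{R}^5$ with $\langle x,y\rangle=-x_1y_1+x_2y_2+x_3y_3+x_4y_4+x_5y_5$, and let $S^4_1=\{x\in\mathbb{R}^5_1:\langle x,x\rangle=1\}$ be the pseudosphere (de Sitter space) with the induced Lorentzian metric, oriented so that a basis $(v_1,\dots,v_4)$ of $T_xS^4_1$ is positive when $(x,v_1,\dots,v_4)$ is a positive basis of $\mathbb{R}^5$. Let $N$ be a connected, oriented, smooth Riemannian surface and $f:N\to S^4_1$ a smooth isometric immersion. A Darboux frame of $f$ at $x\in N$ is a positively oriented orthonormal basis $(e_1,e_2,e_3,e_4)$ of $T_{f(x)}S^4_1$ with $e_1$ timelike such that $(e_3,e_4)$ is the image under $df$ of a positively oriented basis of $T_xN$; the line $TN^{\perp}_{+}=\mathbb{R}(e_1+e_2)$ of positive oriented normal null directions does not depend on the frame. Let $II(X,Y)$ be the component normal to the surface of $\nabla_XY$, where $\nabla$ is the Levi-Civita connection of $S^4_1$. The surface is called $+$isotropic if $II(X,Y)\in TN^{\perp}_{+}$ for all tangent fields $X,Y$ of $N$. Suppose that $f$ is $+$isotropic. Then: 1. If the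 Riemannian manifold $N$ is complete, it is isometric to the unit sphere $S^2\subset\mathbb{R}^3$ with its standard metric. 2. There is an isometry $A$ of $S^4_1$ such that every point of $N$ has an open neighbourhood $U$, a diffeomorphism $\varphi$ from $U$ onto an open subset of $S^2$ and a smooth function $\lambda:S^2\to\mathbb{R}$ with $f=A\circ i_\lambda\circ\varphi$ on $U$, where $i_\lambda:S^2\to S^4_1$ is the map $i_\lambda(y)=(\lambda(y),\lambda(y),y)$, $|y|=1$. -/

import Mathlib

open Bundle Manifold
open scoped ContDiff Topology

noncomputable section

/-- The vector space underlying the Lorentzian space `ℝ⁵₁`. -/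
abbrev R51 : Type := Fin 5 → ℝ

/-- The Lorentzian scalar product `⟨x, y⟩ = -x₁y₁ + x₂y₂ + x₃y₃ + x₄y₄ + x₅y₅` on `ℝ⁵₁`. -/
def lorentzForm : LinearMap.BilinForm ℝ R51 :=
  Matrix.toBilin' (Matrix.diagonal ![-1, 1, 1, 1, 1])

theorem lorentzForm_apply (x y : R51) :
    lorentzForm x y = -(x 0 * y 0) + x 1 * y 1 + x 2 * y 2 + x 3 * y 3 + x 4 * y 4 := by
  simp [lorentzForm, Matrix.toBilin'_apply', dotProduct, Matrix.mulVec_diagonal,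
    Fin.sum_univ_five]

theorem lorentzForm_isRefl : lorentzForm.IsRefl := by
  intro x y h
  rw [lorentzForm_apply] at h ⊢
  linarith

/-- The pseudosphere (de Sitter space) `S⁴₁ = {x ∈ ℝ⁵₁ : ⟨x, x⟩ = 1}`. -/
def pseudosphere : Set R51 := {x | lorentzForm x x = 1}

/-- The isometries of the pseudosphere: the linear automorphisms of `ℝ⁵₁` that preserve the
Lorentzian scalar product (restricted to `S⁴₁`). -/
def IsPseudosphereIsometry (A : R51 ≃ₗ[ℝ] R51) : Prop :=
  ∀ x y, lorentzForm (A x) (A y) = lorentzForm x y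

/-- The unit sphere `S²` in Euclidean three-space. -/
abbrev S2 : Type := Metric.sphere (0 : EuclideanSpace ℝ (Fin 3)) 1

/-- The standard Riemannian metric of `S²`, induced by the inclusion into Euclidean space. -/
def sphereMetric (y : S2) (v w : TangentSpace (𝓡 2) y) : ℝ :=
  let ι : S2 → EuclideanSpace ℝ (Fin 3) := Subtype.val
  let dι : TangentSpace (𝓡 2) y → EuclideanSpace ℝ (Fin 3) :=
    fun u => mfderiv (𝓡 2) 𝓘(ℝ, EuclideanSpace ℝ (Fin 3)) ι y u
  inner ℝ (dι v) (dι w)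

/-- The map `i_l : S² → S⁴₁ ⊂ ℝ⁵₁`, `y ↦ (l(y), l(y), y)`. -/
def modelSurface (l : S2 → ℝ) (y : S2) : R51 :=
  ![l y, l y, y.1 0, y.1 1, y.1 2]

section Surfaces

variable {N : Type*} [TopologicalSpace N] [ChartedSpace (EuclideanSpace ℝ (Fin 2)) N]

/-- A vector field on the surface `N` is smooth at the point `p`. -/
def IsSmoothFieldAt [IsManifold (𝓡 2) 1 N] (X : ∀ x : N, TangentSpace (𝓡 2) x) (p : N) : Prop :=
  ContMDiffAt (𝓡 2) (𝓡 2).tangent ∞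
    (fun x : N => (⟨x, X x⟩ : TangentBundle (𝓡 2) N)) p

variable (N) in
/-- An orientation of the surface `N`: an orientation of every tangent plane such that around
every point there is a smooth positively oriented local frame. -/
structure SurfaceOrientation [IsManifold (𝓡 2) 1 N] where
  orient : ∀ x : N, Orientation ℝ (TangentSpace (𝓡 2) x) (Fin 2)
  exists_frame : ∀ p : N, ∃ X Y : ∀ x : N, TangentSpace (𝓡 2) x,
    IsSmoothFieldAt X p ∧ IsSmoothFieldAt Y p ∧
    ∀ᶠ x in 𝓝 p, ∃ b : Module.Basis (Fin 2) ℝ (TangentSpace (𝓡 2) x),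
      b 0 = X x ∧ b 1 = Y x ∧ b.orientation = orient x

/-- The differential of `f : N → ℝ⁵₁` at `x`. -/
def surfaceDeriv (f : N → R51) (x : N) : TangentSpace (𝓡 2) x →ₗ[ℝ] R51 :=
  (mfderiv (𝓡 2) 𝓘(ℝ, R51) f x : TangentSpace (𝓡 2) x →L[ℝ] R51).toLinearMap

/-- `f` is an isometric immersion of the Riemannian surface `N` into the pseudosphere. -/
structure IsIsometricImmersion [RiemannianBundle (fun x : N => TangentSpace (𝓡 2) x)]
    (f : N → R51) : Prop where
  smooth : ContMDiff (𝓡 2) 𝓘(ℝ, R51) ∞ f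
  mem_pseudosphere : ∀ x, f x ∈ pseudosphere
  isometric : ∀ (x : N) (v w : TangentSpace (𝓡 2) x),
    lorentzForm (surfaceDeriv f x v) (surfaceDeriv f x w) = inner ℝ v w

/-- The Levi-Civita covariant derivative `∇_v Z` of the pseudosphere, for a field `Z` along `f`
tangent to the pseudosphere: the component tangent to `S⁴₁` of the derivative in `ℝ⁵₁`. The
vector `f x` is a unit normal of `S⁴₁` at the point `f x`. -/
def covDeriv (f Z : N → R51) (x : N) (v : TangentSpace (𝓡 2) x) : R51 :=
  surfaceDeriv Z x v - lorentzForm (surfaceDeriv Z x v) (f x) • f x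

open Classical in
/-- The component of `u` orthogonal to the subspace `W`, in the decomposition
`ℝ⁵₁ = W ⊕ W^⊥` (available for nondegenerate `W`). -/
def normalPart (W : Submodule ℝ R51) (u : R51) : R51 :=
  if h : IsCompl W (lorentzForm.orthogonal W) then
    (lorentzForm.orthogonal W).projection W h.symm u
  else 0

/-- The tangent planes of an isometrically immersed surface are complemented by their
orthogonal spaces. -/
theorem IsIsometricImmersion.isCompl [RiemannianBundle (fun x : N => TangentSpace (𝓡 2) x)]
    {f : N → R51} (hf : IsIsometricImmersion f) (x : N) :
    IsCompl (LinearMap.range (surfaceDeriv f x))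
      (lorentzForm.orthogonal (LinearMap.range (surfaceDeriv f x))) := by
  rw [LinearMap.BilinForm.isCompl_orthogonal_iff_disjoint lorentzForm_isRefl,
    Submodule.disjoint_def]
  rintro _ ⟨v, rfl⟩ h
  have h1 := h _ ⟨v, rfl⟩
  replace h1 : lorentzForm (surfaceDeriv f x v) (surfaceDeriv f x v) = 0 := h1
  rw [hf.isometric, inner_self_eq_zero] at h1
  rw [h1, map_zero]

/-- The second fundamental form `II(v, Y)`: the component of `∇_v df(Y)` normal to the surface,
for a tangent vector `v` at `x` and a tangent field `Y` that is smooth at `x`. -/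
def secondFundamentalForm (f : N → R51) (x : N) (v : TangentSpace (𝓡 2) x)
    (Y : ∀ x : N, TangentSpace (𝓡 2) x) : R51 :=
  normalPart (LinearMap.range (surfaceDeriv f x))
    (covDeriv f (fun z => surfaceDeriv f z (Y z)) x v)

/-- `(e 0, e 1, e 2, e 3)` is a Darboux frame of the immersion `f` at `x`: an orthonormal basis of
the tangent space of `S⁴₁` at `f x` with `e 0` timelike, positively oriented (`S⁴₁` being oriented
by its normal `f x` and the standard orientation of `ℝ⁵`), such that `(e 2, e 3)` is the image of
a positively oriented basis of the tangent plane of `N`. -/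
structure IsDarbouxFrame [IsManifold (𝓡 2) 1 N] (o : SurfaceOrientation N)
    (f : N → R51) (x : N) (e : Fin 4 → R51) : Prop where
  orthonormal : ∀ i j, lorentzForm (e i) (e j) =
    Matrix.diagonal (![-1, 1, 1, 1] : Fin 4 → ℝ) i j
  tangent : ∀ i, lorentzForm (f x) (e i) = 0
  positive : 0 < Matrix.det (Matrix.of ![f x, e 0, e 1, e 2, e 3])
  adapted : ∃ b : Module.Basis (Fin 2) ℝ (TangentSpace (𝓡 2) x), b.orientation = o.orient x ∧
    surfaceDeriv f x (b 0) = e 2 ∧ surfaceDeriv f x (b 1) = e 3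

/-- The line `ℝ(e₁ + e₂)` of positive oriented normal null directions of the surface at `x`,
where `(e₁, e₂, e₃, e₄)` is a Darboux frame; it does not depend on the frame. -/
def plusNullLine [IsManifold (𝓡 2) 1 N] (o : SurfaceOrientation N)
    (f : N → R51) (x : N) : Set R51 :=
  {n | ∃ e : Fin 4 → R51, IsDarbouxFrame o f x e ∧ ∃ c : ℝ, n = c • (e 0 + e 1)}

/-- The immersion `f` is `+`isotropic: its second fundamental form takes values in the bundle of
positive oriented normal null directions. -/
def IsPlusIsotropic [IsManifold (𝓡 2) 1 N] (o : SurfaceOrientation N) (f : N → R51) : Prop :=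
  ∀ (x : N) (v : TangentSpace (𝓡 2) x) (Y : ∀ x : N, TangentSpace (𝓡 2) x),
    IsSmoothFieldAt Y x → secondFundamentalForm f x v Y ∈ plusNullLine o f x

variable (N) in
/-- The Riemannian surface `N` is isometric to `S²`: there is a diffeomorphism `N → S²` that pulls
the standard metric of `S²` back to the metric of `N`. -/
def IsIsometricToSphere [RiemannianBundle (fun x : N => TangentSpace (𝓡 2) x)] : Prop :=
  ∃ Φ : N ≃ₘ^∞⟮𝓡 2, 𝓡 2⟯ S2, ∀ (x : N) (v w : TangentSpace (𝓡 2) x),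
    sphereMetric (Φ x) (mfderiv (𝓡 2) (𝓡 2) Φ x v) (mfderiv (𝓡 2) (𝓡 2) Φ x w) = inner ℝ v w

end Surfaces

end

/-! Scale the positive null normal of the surface to have time coordinate 1 and call it `h`. Then
`h` is constant. Indeed `h` is orthogonal to `f`, to the tangent plane, to itself and, by isotropy,
to the second fundamental form. Differentiating these relations shows that `dh` is orthogonal to
`f`, to the tangent plane and to `h`, hence a multiple of `h`; its time coordinate vanishes, so `dh
= 0` (`IsPlusIsotropic.exists_null`). So `f` lies in `n^⊥` for one fixed null vector `n`. A
reflection carries `n` to `(1, 1, 0, 0, 0)`, after which `f = (l, l, y)` with `|y| = 1`. On this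
hyperplane the Lorentz form is the Euclidean product of the last three coordinates, so `y : N → S²`
is a local isometry (`IsIsometricImmersion.exists_sphereMap`), hence a local diffeomorphism. Locally
`l` is a function of `y`, which gives the second claim. If `N` is complete, curves of the sphere
lift through `y`, since a lift is no longer than the curve. Lifting the lines of a stereographic
chart gives sections of `y` off one point; two of them glue to a global inverse
(`bijective_of_isometric`). -/

noncomputable section

/-! ### Vector products and orthonormal frames in Lorentzian space. -/

/-- The Lorentzian vector product of four vectors: the vector representing the linear form
`η ↦ det (a, b, η, c, d)`. -/
def lorentzCross (a b c d : R51) : R51 := fun j =>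
  (![-1, 1, 1, 1, 1] : R51) j * (Matrix.of ![a, b, Pi.single j 1, c, d]).det

/-- Cofactor expansion along the row of `η`; the sign in the time coordinate of `lorentzCross`
cancels the sign in the form. -/
theorem lorentzForm_lorentzCross (a b c d η : R51) :
    lorentzForm (lorentzCross a b c d) η = (Matrix.of ![a, b, η, c, d]).det := by
  have hrow (j : Fin 5) : (Matrix.of ![a, b, η, c, d]).updateRow 2 (Pi.single j 1) =
      Matrix.of ![a, b, Pi.single j 1, c, d] := by
    ext i k
    fin_cases i <;> simp [Matrix.updateRow_apply]
  rw [Matrix.det_eq_sum_mul_adjugate_row _ 2, lorentzForm_apply]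
  simp only [Matrix.adjugate_apply, hrow, Fin.sum_univ_five]
  simp [lorentzCross]
  ring

/-- The vector `J² ξ + ρ J ξ`, where `J` is the rotation by a right angle in the normal plane of
`f`, `u`, `w`, scaled by the area `ρ` of the parallelogram spanned by `u` and `w`. -/
def nullVector (ξ f u w : R51) : R51 :=
  lorentzCross f (lorentzCross f ξ u w) u w +
    √(lorentzForm u u * lorentzForm w w - lorentzForm u w ^ 2) • lorentzCross f ξ u w

theorem lorentzCross_left (a b c d : R51) : lorentzForm (lorentzCross a b c d) a = 0 := by
  rw [lorentzForm_lorentzCross]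
  exact Matrix.det_zero_of_row_eq (i := 0) (j := 2) (by decide) rfl

theorem lorentzCross_second (a b c d : R51) : lorentzForm (lorentzCross a b c d) b = 0 := by
  rw [lorentzForm_lorentzCross]
  exact Matrix.det_zero_of_row_eq (i := 1) (j := 2) (by decide) rfl

theorem lorentzCross_third (a b c d : R51) : lorentzForm (lorentzCross a b c d) c = 0 := by
  rw [lorentzForm_lorentzCross]
  exact Matrix.det_zero_of_row_eq (i := 2) (j := 3) (by decide) rfl

theorem lorentzCross_fourth (a b c d : R51) : lorentzForm (lorentzCross a b c d) d = 0 := by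
  rw [lorentzForm_lorentzCross]
  exact Matrix.det_zero_of_row_eq (i := 2) (j := 4) (by decide) rfl

/-- Skew-adjointness of `ξ ↦ lorentzCross a ξ c d`, by exchanging two rows of the determinant. -/
theorem lorentzCross_swap (a b c d η : R51) :
    lorentzForm (lorentzCross a b c d) η = -lorentzForm (lorentzCross a η c d) b := by
  rw [lorentzForm_lorentzCross, lorentzForm_lorentzCross]
  have h := Matrix.det_permute (Equiv.swap (1 : Fin 5) 2) (Matrix.of ![a, η, b, c, d])
  rw [Equiv.Perm.sign_swap (by decide)] at h
  have h' : (Matrix.of ![a, η, b, c, d]).submatrix (Equiv.swap (1 : Fin 5) 2) id =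
      Matrix.of ![a, b, η, c, d] := by
    ext i j
    fin_cases i <;> rfl
  rw [h'] at h
  rw [h]; simp

theorem lorentzCross_comb (f ξ p q : R51) (a b c d : ℝ) :
    lorentzCross f ξ (a • p + b • q) (c • p + d • q) =
      (a * d - b * c) • lorentzCross f ξ p q := by
  have key (η : R51) : (Matrix.of ![f, ξ, η, a • p + b • q, c • p + d • q]).det =
      (a * d - b * c) * (Matrix.of ![f, ξ, η, p, q]).det := by
    have : Matrix.of ![f, ξ, η, a • p + b • q, c • p + d • q] =
        Matrix.of ![![1, 0, 0, 0, 0], ![0, 1, 0, 0, 0], ![0, 0, 1, 0, 0], ![0, 0, 0, a, b],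
          ![0, 0, 0, c, d]] * Matrix.of ![f, ξ, η, p, q] := by
      ext i j
      rw [Matrix.mul_apply, Fin.sum_univ_five]
      fin_cases i <;> simp
    rw [this, Matrix.det_mul]
    congr 1
    simp [Matrix.det_succ_row_zero, Fin.sum_univ_succ, Fin.succAbove]
    ring
  ext j
  simp only [lorentzCross, key, Pi.smul_apply, smul_eq_mul]
  ring

/-- Orthonormal positively oriented bases of `ℝ⁵₁` whose first vector `f` is completed by a
basis of its orthogonal space with timelike first vector. -/
structure IsPositiveFrame (f : R51) (e : Fin 4 → R51) : Prop where
  unit : lorentzForm f f = 1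
  orthonormal : ∀ i j, lorentzForm (e i) (e j) =
    Matrix.diagonal (![-1, 1, 1, 1] : Fin 4 → ℝ) i j
  tangent : ∀ i, lorentzForm f (e i) = 0
  positive : 0 < Matrix.det (Matrix.of ![f, e 0, e 1, e 2, e 3])

theorem lorentzForm_comm (x y : R51) : lorentzForm x y = lorentzForm y x := by
  simp only [lorentzForm_apply]; ring

namespace IsPositiveFrame

variable {f : R51} {e : Fin 4 → R51} (h : IsPositiveFrame f e)
include h

theorem gram : (Matrix.of ![f, e 0, e 1, e 2, e 3]) * Matrix.diagonal ![-1, 1, 1, 1, 1] *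
    (Matrix.of ![f, e 0, e 1, e 2, e 3]).transpose = Matrix.diagonal ![1, -1, 1, 1, 1] := by
  have key (x y : R51) : ∑ k, x k * (![-1, 1, 1, 1, 1] : R51) k * y k = lorentzForm x y := by
    rw [lorentzForm_apply, Fin.sum_univ_five]; simp
  ext i j
  rw [Matrix.mul_apply]
  simp_rw [Matrix.mul_diagonal]
  simp only [Matrix.transpose_apply, Matrix.of_apply, key]
  have := h.unit
  have := h.tangent
  have ht (i) : lorentzForm (e i) f = 0 := by rw [lorentzForm_comm, h.tangent]
  fin_cases i <;> fin_cases j <;> simp [*, h.orthonormal]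

theorem det_eq_one : (Matrix.of ![f, e 0, e 1, e 2, e 3]).det = 1 := by
  have hg := congrArg Matrix.det h.gram
  rw [Matrix.det_mul, Matrix.det_mul, Matrix.det_transpose, Matrix.det_diagonal,
    Matrix.det_diagonal] at hg
  simp [Fin.prod_univ_five] at hg
  have := h.positive
  nlinarith

/-- The Gram identity exhibits a right inverse of the frame matrix. It is also a left inverse, and
applying that product to `ξ` gives the expansion; the minus sign comes from the timelike `e 0`. -/
theorem expand (ξ : R51) : ξ = lorentzForm f ξ • f - lorentzForm (e 0) ξ • e 0 +
    lorentzForm (e 1) ξ • e 1 + lorentzForm (e 2) ξ • e 2 + lorentzForm (e 3) ξ • e 3 := by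
  set M : Matrix (Fin 5) (Fin 5) ℝ := Matrix.of ![f, e 0, e 1, e 2, e 3] with hM
  have hD : Matrix.diagonal (![1, -1, 1, 1, 1] : Fin 5 → ℝ) *
      Matrix.diagonal ![1, -1, 1, 1, 1] = 1 := by
    rw [Matrix.diagonal_mul_diagonal, ← Matrix.diagonal_one]
    congr 1; ext i; fin_cases i <;> simp
  have h1 : M * (Matrix.diagonal ![-1, 1, 1, 1, 1] * M.transpose *
      Matrix.diagonal ![1, -1, 1, 1, 1]) = 1 := by
    rw [← Matrix.mul_assoc, ← Matrix.mul_assoc, h.gram, hD]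
  have h2 := mul_eq_one_comm.mp h1
  have h3 : Matrix.diagonal ![-1, 1, 1, 1, 1] * (Matrix.diagonal ![-1, 1, 1, 1, 1] *
      M.transpose * Matrix.diagonal ![1, -1, 1, 1, 1] * M) =
      (Matrix.diagonal (![-1, 1, 1, 1, 1] : Fin 5 → ℝ)) := by
    rw [h2, mul_one]
  have hD' : Matrix.diagonal (![-1, 1, 1, 1, 1] : Fin 5 → ℝ) *
      Matrix.diagonal ![-1, 1, 1, 1, 1] = 1 := by
    rw [Matrix.diagonal_mul_diagonal, ← Matrix.diagonal_one]
    congr 1; ext i; fin_cases i <;> simp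
  have h4 : M.transpose * Matrix.diagonal ![1, -1, 1, 1, 1] * M *
      Matrix.diagonal (![-1, 1, 1, 1, 1] : Fin 5 → ℝ) = 1 := by
    simp only [← Matrix.mul_assoc] at h3
    rw [hD', Matrix.one_mul] at h3
    rw [h3, hD']
  have h5 := congrArg (fun A => A.mulVec ξ) h4
  simp only [Matrix.one_mulVec] at h5
  ext k
  rw [← congrFun h5 k]
  simp only [← Matrix.mulVec_mulVec]
  simp [Matrix.mulVec, dotProduct, Fin.sum_univ_five, Matrix.diagonal_apply, hM, lorentzForm_apply]
  ring

theorem eq_zero {ξ : R51} (hf : lorentzForm f ξ = 0) (he : ∀ i, lorentzForm (e i) ξ = 0) :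
    ξ = 0 := by
  rw [h.expand ξ]; simp [hf, he]

theorem lorentzCross_zero : lorentzCross f (e 0) (e 2) (e 3) = e 1 := by
  refine sub_eq_zero.mp (h.eq_zero ?_ fun i => ?_)
  · rw [map_sub, lorentzForm_comm, lorentzCross_left, h.tangent, sub_zero]
  · rw [map_sub, lorentzForm_comm, h.orthonormal]
    fin_cases i
    · simp [lorentzCross_second]
    · simp [lorentzForm_lorentzCross, h.det_eq_one]
    · simp [lorentzCross_third]
    · simp [lorentzCross_fourth]

theorem lorentzCross_one : lorentzCross f (e 1) (e 2) (e 3) = e 0 := by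
  refine sub_eq_zero.mp (h.eq_zero ?_ fun i => ?_)
  · rw [map_sub, lorentzForm_comm, lorentzCross_left, h.tangent, sub_zero]
  · rw [map_sub, lorentzForm_comm, h.orthonormal]
    fin_cases i
    · simp [lorentzCross_swap f (e 1), h.lorentzCross_zero, h.orthonormal]
    · simp [lorentzCross_second]
    · simp [lorentzCross_third]
    · simp [lorentzCross_fourth]

/-- The normal plane is Lorentzian, so this operator `J` exchanges `e 0` and `e 1`: it is an
involution there, with eigenlines `ℝ(e 0 ± e 1)`. Hence `J² + J` maps onto `ℝ(e 0 + e 1)`. -/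
theorem lorentzCross_eq (ξ : R51) : lorentzCross f ξ (e 2) (e 3) =
    lorentzForm (e 1) ξ • e 0 - lorentzForm (e 0) ξ • e 1 := by
  refine sub_eq_zero.mp (h.eq_zero ?_ fun i => ?_)
  · rw [map_sub, lorentzForm_comm, lorentzCross_left]
    simp [h.tangent]
  · rw [map_sub, lorentzForm_comm]
    fin_cases i
    · simp [lorentzCross_swap f ξ, h.lorentzCross_zero, h.orthonormal]
    · simp [lorentzCross_swap f ξ, h.lorentzCross_one, h.orthonormal]
    · simp [lorentzCross_third, h.orthonormal]
    · simp [lorentzCross_fourth, h.orthonormal]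

theorem gram_comb (a b c d : ℝ) :
    lorentzForm (a • e 2 + b • e 3) (a • e 2 + b • e 3) *
      lorentzForm (c • e 2 + d • e 3) (c • e 2 + d • e 3) -
      lorentzForm (a • e 2 + b • e 3) (c • e 2 + d • e 3) ^ 2 = (a * d - b * c) ^ 2 := by
  simp [h.orthonormal]
  ring

/-- The null vector of a positively oriented pair of tangent vectors spans the line of
`e 0 + e 1`. -/
theorem nullVector_eq (ξ : R51) {a b c d : ℝ} (hρ : 0 < a * d - b * c) :
    nullVector ξ f (a • e 2 + b • e 3) (c • e 2 + d • e 3) =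
      ((a * d - b * c) ^ 2 * (lorentzForm (e 1) ξ - lorentzForm (e 0) ξ)) • (e 0 + e 1) := by
  -- Here orientation selects the null line: for a negatively oriented pair the root would be `-(a *
  -- d - b * c)`, and the vector would lie on `ℝ(e 0 - e 1)`.
  have hs : √(lorentzForm (a • e 2 + b • e 3) (a • e 2 + b • e 3) *
      lorentzForm (c • e 2 + d • e 3) (c • e 2 + d • e 3) -
      lorentzForm (a • e 2 + b • e 3) (c • e 2 + d • e 3) ^ 2) = a * d - b * c := by
    rw [h.gram_comb, Real.sqrt_sq hρ.le]
  rw [nullVector, hs]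
  simp only [lorentzCross_comb, h.lorentzCross_eq]
  simp only [map_sub, map_smul, smul_eq_mul, h.orthonormal]
  simp
  module

end IsPositiveFrame

/-! ### Null directions normalised by their time coordinate. -/

theorem eq_zero_of_null {n : R51} (h : lorentzForm n n = 0) (h0 : n 0 = 0) : n = 0 := by
  rw [lorentzForm_apply, h0] at h
  have key (i : Fin 5) (hi : n i ^ 2 ≤ 0) : n i = 0 :=
    pow_eq_zero_iff two_ne_zero |>.mp (le_antisymm hi (sq_nonneg _))
  have h1 := key 1 (by nlinarith [sq_nonneg (n 2), sq_nonneg (n 3), sq_nonneg (n 4)])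
  have h2 := key 2 (by nlinarith [sq_nonneg (n 1), sq_nonneg (n 3), sq_nonneg (n 4)])
  have h3 := key 3 (by nlinarith [sq_nonneg (n 1), sq_nonneg (n 2), sq_nonneg (n 4)])
  have h4 := key 4 (by nlinarith [sq_nonneg (n 1), sq_nonneg (n 2), sq_nonneg (n 3)])
  ext i
  fin_cases i <;> assumption

/-- The null vector with time coordinate `1` on the line of `e 0 + e 1`. -/
def normalizedNull (e : Fin 4 → R51) : R51 := (e 0 0 + e 1 0)⁻¹ • (e 0 + e 1)

namespace IsPositiveFrame

variable {f : R51} {e : Fin 4 → R51} (h : IsPositiveFrame f e)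
include h

theorem null : lorentzForm (e 0 + e 1) (e 0 + e 1) = 0 := by
  simp [h.orthonormal]

theorem time_ne_zero : e 0 0 + e 1 0 ≠ 0 := by
  intro h0
  have h1 := eq_zero_of_null h.null h0
  have h2 := congrArg (lorentzForm (e 1)) h1
  simp [h.orthonormal] at h2

theorem smul_normalizedNull : (e 0 0 + e 1 0) • normalizedNull e = e 0 + e 1 := by
  rw [normalizedNull, smul_inv_smul₀ h.time_ne_zero]

theorem normalizedNull_zero : normalizedNull e 0 = 1 := by
  simp [normalizedNull, inv_mul_cancel₀ h.time_ne_zero]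

theorem normalizedNull_null : lorentzForm (normalizedNull e) (normalizedNull e) = 0 := by
  rw [normalizedNull, map_smul, map_smul, LinearMap.smul_apply, h.null]; simp

theorem lorentzForm_normalizedNull : lorentzForm f (normalizedNull e) = 0 := by
  simp [normalizedNull, h.tangent]

theorem lorentzForm_normalizedNull_two : lorentzForm (e 2) (normalizedNull e) = 0 := by
  simp [normalizedNull, h.orthonormal]

theorem lorentzForm_normalizedNull_three : lorentzForm (e 3) (normalizedNull e) = 0 := by
  simp [normalizedNull, h.orthonormal]

/-- Normalising cancels the scalar in `nullVector_eq`. The null direction thus becomes an explicit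
expression in `f`, `u`, `w`, and no Darboux frame has to be chosen smoothly. -/
theorem normalizedNull_eq {ξ : R51} (hξ : lorentzForm (e 1) ξ - lorentzForm (e 0) ξ ≠ 0)
    {a b c d : ℝ} (hρ : 0 < a * d - b * c) {u w : R51} (hu : u = a • e 2 + b • e 3)
    (hw : w = c • e 2 + d • e 3) :
    normalizedNull e = (nullVector ξ f u w 0)⁻¹ • nullVector ξ f u w := by
  have hk : (a * d - b * c) ^ 2 * (lorentzForm (e 1) ξ - lorentzForm (e 0) ξ) ≠ 0 :=
    mul_ne_zero (pow_ne_zero _ hρ.ne') hξ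
  rw [hu, hw, h.nullVector_eq ξ hρ, normalizedNull, smul_smul]
  congr 1
  simp only [Pi.smul_apply, Pi.add_apply, smul_eq_mul]
  field_simp

/-- Two frames adapted to the same oriented plane have the same null direction. -/
theorem normalizedNull_congr {e' : Fin 4 → R51} (h' : IsPositiveFrame f e')
    {a b c d : ℝ} (hρ : 0 < a * d - b * c) (hu : e' 2 = a • e 2 + b • e 3)
    (hw : e' 3 = c • e 2 + d • e 3) : normalizedNull e = normalizedNull e' := by
  -- Two proper hyperplanes do not cover the space: if neither `e 0` nor `e' 0` avoids both kernels,
  -- their sum does.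
  obtain ⟨ξ, h1, h2⟩ : ∃ ξ, lorentzForm (e 1) ξ - lorentzForm (e 0) ξ ≠ 0 ∧
      lorentzForm (e' 1) ξ - lorentzForm (e' 0) ξ ≠ 0 := by
    by_contra! H
    have e1 : lorentzForm (e 1) (e 0) - lorentzForm (e 0) (e 0) ≠ 0 := by simp [h.orthonormal]
    have e2 : lorentzForm (e' 1) (e' 0) - lorentzForm (e' 0) (e' 0) ≠ 0 := by
      simp [h'.orthonormal]
    have e3 := H _ e1
    have e4 : lorentzForm (e 1) (e' 0) - lorentzForm (e 0) (e' 0) = 0 := by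
      by_contra h0; exact e2 (H _ h0)
    have e5 := H (e 0 + e' 0) (by
      simp only [map_add]
      intro h0; apply e1; linarith)
    simp only [map_add] at e5
    apply e2; linarith
  rw [h.normalizedNull_eq h1 hρ hu hw, h'.normalizedNull_eq (a := 1) (b := 0) (c := 0) (d := 1) h2
    (by norm_num) (u := e' 2) (w := e' 3) (by simp) (by simp)]

/-- A vector without time component that is orthogonal to the plane of `e 2`, `e 3` and to the
null direction vanishes. -/
theorem eq_zero_of_orthogonal {z : R51} (hf : lorentzForm f z = 0)
    (h2 : lorentzForm (e 2) z = 0) (h3 : lorentzForm (e 3) z = 0)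
    (hn : lorentzForm (normalizedNull e) z = 0) (h0 : z 0 = 0) : z = 0 := by
  have h1 : lorentzForm (e 0) z + lorentzForm (e 1) z = 0 := by
    rw [← LinearMap.add_apply, ← map_add, ← h.smul_normalizedNull, map_smul,
      LinearMap.smul_apply, hn, smul_zero]
  have hz : z = (-lorentzForm (e 0) z) • (e 0 + e 1) := by
    conv_lhs => rw [h.expand z, hf, h2, h3, eq_neg_of_add_eq_zero_right h1]
    module
  have hc := congrFun hz 0
  rw [h0] at hc
  rcases mul_eq_zero.mp hc.symm with hc | hc
  · rw [hz, hc, zero_smul]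
  · exact absurd hc h.time_ne_zero

end IsPositiveFrame

/-! ### Reflections of Lorentzian space. -/

/-- The reflection of `ℝ⁵₁` along `r`. -/
def lorentzReflection (r : R51) : R51 →ₗ[ℝ] R51 :=
  LinearMap.id - (LinearMap.toSpanSingleton ℝ R51 r).comp
    ((2 / lorentzForm r r) • lorentzForm r)

theorem lorentzReflection_apply (r x : R51) :
    lorentzReflection r x = x - (2 / lorentzForm r r * lorentzForm r x) • r := by
  simp [lorentzReflection]

theorem lorentzForm_lorentzReflection (r x y : R51) :
    lorentzForm (lorentzReflection r x) (lorentzReflection r y) = lorentzForm x y := by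
  simp only [lorentzReflection_apply, map_sub, map_smul, LinearMap.sub_apply, LinearMap.smul_apply,
    smul_eq_mul, lorentzForm_comm x r]
  -- For null `r` the quotient `2 / 0` is `0`, and the map is the identity.
  by_cases h : lorentzForm r r = 0
  · simp [h]
  · field_simp; ring

theorem lorentzReflection_involutive (r : R51) :
    Function.Involutive (lorentzReflection r) := by
  intro x
  simp only [lorentzReflection_apply, map_sub, map_smul]
  by_cases h : lorentzForm r r = 0
  · simp [h]
  · rw [div_mul_cancel₀ _ h]
    module

/-- The reflection of `ℝ⁵₁` along `r`, as a linear equivalence. -/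
def lorentzReflectionEquiv (r : R51) : R51 ≃ₗ[ℝ] R51 :=
  LinearEquiv.ofInvolutive (lorentzReflection r) (lorentzReflection_involutive r)

/-- Reflections act transitively on the null vectors with time component `1`. -/
theorem lorentzReflection_null {n k : R51} (hn : lorentzForm n n = 0) (hk : lorentzForm k k = 0)
    (h : n 0 = k 0) : lorentzReflection (n - k) n = k := by
  rw [lorentzReflection_apply]
  have h1 : lorentzForm (n - k) (n - k) = -2 * lorentzForm n k := by
    simp only [map_sub, LinearMap.sub_apply, hn, hk, lorentzForm_comm k n]; ring
  have h2 : lorentzForm (n - k) n = -lorentzForm n k := by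
    simp only [map_sub, LinearMap.sub_apply, hn, lorentzForm_comm k n]; ring
  -- Orthogonal null vectors with equal time coordinates coincide, as their difference is null
  -- without time component.
  by_cases h3 : lorentzForm n k = 0
  · have : n - k = 0 := by
      refine eq_zero_of_null (by rw [h1, h3, mul_zero]) ?_
      simp [h]
    simp only [this, smul_zero, sub_zero]
    exact sub_eq_zero.mp this
  · rw [h1, h2]
    have : 2 / (-2 * lorentzForm n k) * -lorentzForm n k = 1 := by field_simp
    rw [this, one_smul, sub_sub_cancel]

/-! ### Differentiability of the null direction. -/

theorem Differentiable.matrix_det' {E n : Type*} [NormedAddCommGroup E] [NormedSpace ℝ E]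
    [Fintype n] [DecidableEq n] {M : E → Matrix n n ℝ}
    (h : ∀ i j, Differentiable ℝ fun x => M x i j) : Differentiable ℝ fun x => (M x).det := by
  simp only [Matrix.det_apply]
  fun_prop

theorem Differentiable.lorentzCross {E : Type*} [NormedAddCommGroup E] [NormedSpace ℝ E]
    {a b c d : E → R51} (ha : Differentiable ℝ a) (hb : Differentiable ℝ b)
    (hc : Differentiable ℝ c) (hd : Differentiable ℝ d) :
    Differentiable ℝ fun x => lorentzCross (a x) (b x) (c x) (d x) := by
  rw [differentiable_pi]
  intro j
  have h2 : Differentiable ℝ fun x => (Matrix.of ![a x, b x, Pi.single j 1, c x, d x]).det := by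
    refine .matrix_det' fun i k => ?_
    fin_cases i
    exacts [differentiable_pi.mp ha k, differentiable_pi.mp hb k, differentiable_const _,
      differentiable_pi.mp hc k, differentiable_pi.mp hd k]
  exact h2.const_mul ((![-1, 1, 1, 1, 1] : R51) j)

theorem Differentiable.lorentzForm {E : Type*} [NormedAddCommGroup E] [NormedSpace ℝ E]
    {a b : E → R51} (ha : Differentiable ℝ a) (hb : Differentiable ℝ b) :
    Differentiable ℝ fun x => lorentzForm (a x) (b x) := by
  simp only [lorentzForm_apply]
  rw [differentiable_pi] at ha hb
  fun_prop

theorem differentiableAt_nullVector {E : Type*} [NormedAddCommGroup E] [NormedSpace ℝ E]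
    {ξ : R51} {f u w : E → R51} {x : E} (hf : Differentiable ℝ f) (hu : Differentiable ℝ u)
    (hw : Differentiable ℝ w)
    (h : lorentzForm (u x) (u x) * lorentzForm (w x) (w x) - lorentzForm (u x) (w x) ^ 2 ≠ 0) :
    DifferentiableAt ℝ (fun q => nullVector ξ (f q) (u q) (w q)) x := by
  have h1 : Differentiable ℝ fun q => lorentzCross (f q) ξ (u q) (w q) :=
    .lorentzCross hf (differentiable_const ξ) hu hw
  have h2 : Differentiable ℝ fun q =>
      lorentzCross (f q) (lorentzCross (f q) ξ (u q) (w q)) (u q) (w q) :=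
    .lorentzCross hf h1 hu hw
  have h3 : Differentiable ℝ fun q =>
      lorentzForm (u q) (u q) * lorentzForm (w q) (w q) - lorentzForm (u q) (w q) ^ 2 :=
    ((hu.lorentzForm hu).mul (hw.lorentzForm hw)).sub ((hu.lorentzForm hw).pow 2)
  have h4 := (h3.differentiableAt.sqrt h).fun_smul h1.differentiableAt
  exact h2.differentiableAt.fun_add h4

section Surfaces

variable {N : Type*} [TopologicalSpace N] [ChartedSpace (EuclideanSpace ℝ (Fin 2)) N]

theorem IsDarbouxFrame.isPositiveFrame [IsManifold (𝓡 2) 1 N] {o : SurfaceOrientation N}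
    {f : N → R51} {x : N} {e : Fin 4 → R51} (h : IsDarbouxFrame o f x e)
    (hf : f x ∈ pseudosphere) : IsPositiveFrame (f x) e :=
  ⟨hf, h.orthonormal, h.tangent, h.positive⟩

/-- Positively oriented bases of the tangent plane are positive combinations of the tangent
vectors of a Darboux frame. -/
theorem IsDarbouxFrame.exists_coeff [IsManifold (𝓡 2) 1 N] {o : SurfaceOrientation N}
    {f : N → R51} {x : N} {e : Fin 4 → R51} (h : IsDarbouxFrame o f x e)
    (b : Module.Basis (Fin 2) ℝ (TangentSpace (𝓡 2) x)) (hb : b.orientation = o.orient x) :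
    ∃ α β γ δ : ℝ, 0 < α * δ - β * γ ∧ surfaceDeriv f x (b 0) = α • e 2 + β • e 3 ∧
      surfaceDeriv f x (b 1) = γ • e 2 + δ • e 3 := by
  obtain ⟨b', hb', h2, h3⟩ := h.adapted
  have hdet := (b'.orientation_eq_iff_det_pos b).mp (hb'.trans hb.symm)
  rw [Module.Basis.det_apply, Matrix.det_fin_two] at hdet
  simp only [Module.Basis.toMatrix_apply] at hdet
  have key (v : TangentSpace (𝓡 2) x) :
      surfaceDeriv f x v = b'.repr v 0 • e 2 + b'.repr v 1 • e 3 := by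
    conv_lhs => rw [← b'.sum_repr v, Fin.sum_univ_two, map_add, map_smul, map_smul, h2, h3]
  refine ⟨b'.repr (b 0) 0, b'.repr (b 0) 1, b'.repr (b 1) 0, b'.repr (b 1) 1, ?_, key _, key _⟩
  linarith

theorem IsDarbouxFrame.normalizedNull_eq [IsManifold (𝓡 2) 1 N] {o : SurfaceOrientation N}
    {f : N → R51} {x : N} (hf : f x ∈ pseudosphere) {e e' : Fin 4 → R51}
    (h : IsDarbouxFrame o f x e) (h' : IsDarbouxFrame o f x e') :
    normalizedNull e = normalizedNull e' := by
  obtain ⟨b', hb', h2, h3⟩ := h'.adapted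
  obtain ⟨α, β, γ, δ, hρ, h4, h5⟩ := h.exists_coeff b' hb'
  exact (h.isPositiveFrame hf).normalizedNull_congr (h'.isPositiveFrame hf) hρ
    (h2.symm.trans h4) (h3.symm.trans h5)

theorem IsSmoothFieldAt.surfaceDeriv [IsManifold (𝓡 2) ∞ N]
    {X : ∀ x : N, TangentSpace (𝓡 2) x} {p : N} (hX : IsSmoothFieldAt X p) {f : N → R51}
    (hf : ContMDiff (𝓡 2) 𝓘(ℝ, R51) ∞ f) :
    ContMDiffAt (𝓡 2) 𝓘(ℝ, R51) ∞ (fun z => surfaceDeriv f z (X z)) p := by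
  have h1 := (hf.contMDiff_tangentMap (m := ∞) (by simp)).contMDiffAt.comp p hX
  exact (contMDiff_snd_tangentBundle_modelSpace R51 𝓘(ℝ, R51)).contMDiffAt.comp p h1

theorem exists_isSmoothFieldAt [IsManifold (𝓡 2) ∞ N] {p : N} (v : TangentSpace (𝓡 2) p) :
    ∃ X : ∀ x : N, TangentSpace (𝓡 2) x, IsSmoothFieldAt X p ∧ X p = v :=
  ⟨_, FiberBundle.contMDiffAt_extend (𝓡 2) (EuclideanSpace ℝ (Fin 2)) v,
    FiberBundle.extend_apply_self _ v⟩

/-- The Darboux frames are chosen pointwise without any regularity. Differentiability at `p` holds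
because nearby the field equals the normalised `nullVector` of the smooth local frame supplied by
the orientation. -/
theorem exists_nullField [IsManifold (𝓡 2) ∞ N] {o : SurfaceOrientation N} {f : N → R51}
    (hf : ContMDiff (𝓡 2) 𝓘(ℝ, R51) ∞ f) (hfp : ∀ x, f x ∈ pseudosphere)
    (he : ∀ x, ∃ e, IsDarbouxFrame o f x e) :
    ∃ h : N → R51, (∀ x e, IsDarbouxFrame o f x e → normalizedNull e = h x) ∧
      MDifferentiable (𝓡 2) 𝓘(ℝ, R51) h := by
  choose e he using he
  refine ⟨fun x => normalizedNull (e x), fun x e' he' => he'.normalizedNull_eq (hfp x) (he x), ?_⟩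
  intro p
  obtain ⟨X, Y, hX, hY, hXY⟩ := o.exists_frame p
  -- A fixed vector whose null vector at `p` is nonzero, since `⟨e 1, ξ⟩ - ⟨e 0, ξ⟩ = 1` there; by
  -- continuity it stays nonzero near `p`.
  set ξ := e p 0 with hξ
  let n : N → R51 := fun x => nullVector ξ (f x) (surfaceDeriv f x (X x)) (surfaceDeriv f x (Y x))
  have hF := (he p).isPositiveFrame (hfp p)
  obtain ⟨b, hb0, hb1, hb⟩ := hXY.self_of_nhds
  obtain ⟨α, β, γ, δ, hρ, h4, h5⟩ := (he p).exists_coeff b hb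
  rw [hb0] at h4
  rw [hb1] at h5
  have hn : MDifferentiableAt (𝓡 2) 𝓘(ℝ, R51) n p := by
    have h1 := (hf.contMDiffAt (x := p)).mdifferentiableAt (by simp)
    have h2 := (hX.surfaceDeriv hf).mdifferentiableAt (by simp)
    have h3 := (hY.surfaceDeriv hf).mdifferentiableAt (by simp)
    have h6 : DifferentiableAt ℝ (fun q : R51 × R51 × R51 => nullVector ξ q.1 q.2.1 q.2.2)
        (f p, surfaceDeriv f p (X p), surfaceDeriv f p (Y p)) := by
      refine differentiableAt_nullVector differentiable_fst
        (differentiable_fst.comp differentiable_snd)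
        (differentiable_snd.comp differentiable_snd) ?_
      simp only [h4, h5, hF.gram_comb]
      exact pow_ne_zero _ hρ.ne'
    exact h6.mdifferentiableAt.comp p (h1.prodMk_space (h2.prodMk_space h3))
  have hnp : n p 0 ≠ 0 := by
    simp only [n, h4, h5, hF.nullVector_eq ξ hρ]
    refine mul_ne_zero (mul_ne_zero (pow_ne_zero _ hρ.ne') ?_) hF.time_ne_zero
    simp [hξ, hF.orthonormal]
  have hn0 : MDifferentiableAt (𝓡 2) 𝓘(ℝ, ℝ) (fun x => n x 0) p :=
    (differentiableAt_apply (𝕜 := ℝ) (0 : Fin 5) (n p)).mdifferentiableAt.comp p hn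
  have hev : (fun x => normalizedNull (e x)) =ᶠ[𝓝 p] fun x => (n x 0)⁻¹ • n x := by
    filter_upwards [hXY, hn0.continuousAt.eventually_ne hnp] with x ⟨b, hb0, hb1, hb⟩ hx
    obtain ⟨α, β, γ, δ, hρ, h4, h5⟩ := (he x).exists_coeff b hb
    rw [hb0] at h4
    rw [hb1] at h5
    have hF := (he x).isPositiveFrame (hfp x)
    refine hF.normalizedNull_eq ?_ hρ h4 h5
    intro h0
    apply hx
    simp [n, h4, h5, hF.nullVector_eq ξ hρ, h0]
  refine MDifferentiableAt.congr_of_eventuallyEq ?_ hev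
  have := (differentiableAt_inv hnp).mdifferentiableAt.comp p hn0
  exact this.smul hn

theorem mfderiv_eq_zero_imp_const [ConnectedSpace N] {h : N → R51} [IsManifold (𝓡 2) ∞ N]
    (hd : MDifferentiable (𝓡 2) 𝓘(ℝ, R51) h) (h0 : ∀ x, mfderiv (𝓡 2) 𝓘(ℝ, R51) h x = 0)
    (x y : N) : h x = h y := by
  refine IsLocallyConstant.apply_eq_of_preconnectedSpace
    ((IsLocallyConstant.iff_eventually_eq h).mpr fun p => ?_) x y
  let φ := extChartAt (𝓡 2) p
  obtain ⟨r, hr, hball⟩ := Metric.isOpen_iff.mp (isOpen_extChartAt_target (I := 𝓡 2) p) (φ p)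
    (mem_extChartAt_target p)
  have key (z) (hz : z ∈ Metric.ball (φ p) r) : HasFDerivAt (h ∘ φ.symm) (0 : _ →L[ℝ] R51) z := by
    have h1 := (contMDiffOn_extChartAt_symm (n := ∞) (I := 𝓡 2) p).contMDiffAt
      ((isOpen_extChartAt_target (I := 𝓡 2) p).mem_nhds (hball hz))
    have h2 := (hd (φ.symm z)).hasMFDerivAt.comp z
      (h1.mdifferentiableAt (by simp)).hasMFDerivAt
    rw [h0, ContinuousLinearMap.zero_comp] at h2
    exact h2.hasFDerivAt
  have hnhds : φ ⁻¹' Metric.ball (φ p) r ∈ 𝓝 p :=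
    (continuousAt_extChartAt p).preimage_mem_nhds (Metric.ball_mem_nhds _ hr)
  filter_upwards [hnhds, extChartAt_source_mem_nhds (I := 𝓡 2) p] with q hq hq'
  have h3 := (convex_ball (φ p) r).is_const_of_fderivWithin_eq_zero (𝕜 := ℝ) (f := h ∘ φ.symm)
    (fun z hz => (key z hz).differentiableAt.differentiableWithinAt)
    (fun z hz => (key z hz).hasFDerivWithinAt.fderivWithin
      (Metric.isOpen_ball.uniqueDiffWithinAt hz)) hq (Metric.mem_ball_self hr)
  simp only [Function.comp_apply] at h3
  rwa [φ.left_inv hq', φ.left_inv (mem_extChartAt_source p)] at h3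

end Surfaces

/-! ### Constancy of the null direction. -/

section Surfaces

variable {N : Type*} [TopologicalSpace N] [ChartedSpace (EuclideanSpace ℝ (Fin 2)) N]

theorem lorentzForm_surfaceDeriv_add {a b : N → R51} {x : N} {c : ℝ}
    (ha : MDifferentiableAt (𝓡 2) 𝓘(ℝ, R51) a x) (hb : MDifferentiableAt (𝓡 2) 𝓘(ℝ, R51) b x)
    (h : ∀ z, lorentzForm (a z) (b z) = c) (v : TangentSpace (𝓡 2) x) :
    lorentzForm (surfaceDeriv a x v) (b x) + lorentzForm (a x) (surfaceDeriv b x v) = 0 := by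
  let B : R51 →L[ℝ] R51 →L[ℝ] ℝ := lorentzForm.toContinuousBilinearMap
  have hab : HasMFDerivAt (𝓡 2) 𝓘(ℝ, R51 × R51) (fun z => (a z, b z)) x
      ((mfderiv (𝓡 2) 𝓘(ℝ, R51) a x : EuclideanSpace ℝ (Fin 2) →L[ℝ] R51).prod
        (mfderiv (𝓡 2) 𝓘(ℝ, R51) b x)) :=
    ⟨ha.continuousAt.prodMk hb.continuousAt, ha.hasMFDerivAt.2.prodMk hb.hasMFDerivAt.2⟩
  have h1 := HasMFDerivAt.comp x
    (B.isBoundedBilinearMap.hasFDerivAt (a x, b x)).hasMFDerivAt hab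
  have h2 : ((fun p : R51 × R51 => B p.1 p.2) ∘ fun z => (a z, b z)) = fun _ => c :=
    funext fun z => h z
  rw [h2] at h1
  have h3 := hasMFDerivAt_unique h1 (hasMFDerivAt_const c x)
  have h4 := congrArg (fun L => L v) h3
  have h5 : B (a x) (surfaceDeriv b x v) + B (surfaceDeriv a x v) (b x) = 0 := h4
  rw [add_comm]
  exact h5

theorem surfaceDeriv_time {h : N → R51} {x : N} {c : ℝ}
    (hd : MDifferentiableAt (𝓡 2) 𝓘(ℝ, R51) h x) (h0 : ∀ z, h z 0 = c)
    (v : TangentSpace (𝓡 2) x) : surfaceDeriv h x v 0 = 0 := by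
  have h1 := (ContinuousLinearMap.proj (R := ℝ) (φ := fun _ : Fin 5 => ℝ) 0).hasFDerivAt
    (x := h x) |>.hasMFDerivAt.comp x hd.hasMFDerivAt
  have h2 : ((ContinuousLinearMap.proj (R := ℝ) (φ := fun _ : Fin 5 => ℝ) 0) ∘ h) = fun _ => c :=
    funext fun z => h0 z
  rw [h2] at h1
  exact congrArg (fun L => L v) (hasMFDerivAt_unique h1 (hasMFDerivAt_const c x))

theorem normalPart_sub_mem {W : Submodule ℝ R51} (h : IsCompl W (lorentzForm.orthogonal W))
    (u : R51) : u - normalPart W u ∈ W := by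
  rw [normalPart, dif_pos h]
  exact Submodule.sub_projection_mem h.symm u

variable [IsManifold (𝓡 2) ∞ N]

theorem IsDarbouxFrame.exists_tangent {o : SurfaceOrientation N} {f : N → R51} {x : N}
    {e : Fin 4 → R51} (h : IsDarbouxFrame o f x e) (v : TangentSpace (𝓡 2) x) :
    ∃ α β : ℝ, surfaceDeriv f x v = α • e 2 + β • e 3 := by
  obtain ⟨b', -, h2, h3⟩ := h.adapted
  exact ⟨b'.repr v 0, b'.repr v 1, by
    conv_lhs => rw [← b'.sum_repr v, Fin.sum_univ_two, map_add, map_smul, map_smul, h2, h3]⟩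

/-- The null direction of a `+`isotropic surface is constant. -/
theorem IsPlusIsotropic.exists_null [ConnectedSpace N]
    [RiemannianBundle (fun x : N => TangentSpace (𝓡 2) x)] {o : SurfaceOrientation N} {f : N → R51}
    (hiso : IsPlusIsotropic o f) (hf : IsIsometricImmersion f) :
    ∃ n : R51, n 0 = 1 ∧ lorentzForm n n = 0 ∧ ∀ x, lorentzForm n (f x) = 0 := by
  -- Membership in `plusNullLine` carries a Darboux frame, so isotropy applied to any smooth field
  -- already provides one.
  have hex (x : N) : ∃ e, IsDarbouxFrame o f x e := by
    obtain ⟨X, hX, -⟩ := exists_isSmoothFieldAt (0 : TangentSpace (𝓡 2) x)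
    obtain ⟨e, he, -⟩ := hiso x 0 X hX
    exact ⟨e, he⟩
  obtain ⟨h, hh, hd⟩ := exists_nullField hf.smooth hf.mem_pseudosphere hex
  choose e he using hex
  have hF (x) := (he x).isPositiveFrame (hf.mem_pseudosphere x)
  have h0 (x) : h x 0 = 1 := by rw [← hh x _ (he x)]; exact (hF x).normalizedNull_zero
  have hnull (x) : lorentzForm (h x) (h x) = 0 := by
    rw [← hh x _ (he x)]; exact (hF x).normalizedNull_null
  have hperp (x) : lorentzForm (f x) (h x) = 0 := by
    rw [← hh x _ (he x)]; exact (hF x).lorentzForm_normalizedNull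
  have htan (x) (v : TangentSpace (𝓡 2) x) : lorentzForm (surfaceDeriv f x v) (h x) = 0 := by
    obtain ⟨α, β, hv⟩ := (he x).exists_tangent v
    rw [hv, ← hh x _ (he x)]
    simp [(hF x).lorentzForm_normalizedNull_two, (hF x).lorentzForm_normalizedNull_three]
  have hII (x) (m) (hm : m ∈ plusNullLine o f x) : lorentzForm m (h x) = 0 := by
    obtain ⟨e', he', c, rfl⟩ := hm
    rw [← (he'.isPositiveFrame (hf.mem_pseudosphere x)).smul_normalizedNull, hh x _ he']
    simp [hnull]
  have hzero (x) : mfderiv (𝓡 2) 𝓘(ℝ, R51) h x = 0 := by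
    ext1 v
    change surfaceDeriv h x v = 0
    have hfd := (hf.smooth x).mdifferentiableAt (by simp)
    -- Differentiate `⟨df Y, h⟩ = 0`: the derivative of `df Y` is the second fundamental form plus a
    -- tangent vector plus a multiple of `f`, all orthogonal to `h`.
    have key (w : TangentSpace (𝓡 2) x) :
        lorentzForm (surfaceDeriv f x w) (surfaceDeriv h x v) = 0 := by
      obtain ⟨Y, hY, rfl⟩ := exists_isSmoothFieldAt w
      have h1 := lorentzForm_surfaceDeriv_add
        ((hY.surfaceDeriv hf.smooth).mdifferentiableAt (by simp)) (hd x)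
        (fun z => htan z (Y z)) v
      have h2 := hII x _ (hiso x v Y hY)
      obtain ⟨w, hw⟩ := normalPart_sub_mem (hf.isCompl x)
        (covDeriv f (fun z => surfaceDeriv f z (Y z)) x v)
      have h3 := htan x w
      rw [hw, map_sub, LinearMap.sub_apply, ← secondFundamentalForm, h2, sub_zero, covDeriv] at h3
      simp only [map_sub, map_smul, LinearMap.sub_apply, LinearMap.smul_apply, hperp,
        smul_zero, sub_zero] at h3
      rwa [h3, zero_add] at h1
    obtain ⟨b, -, hb2, hb3⟩ := (he x).adapted
    refine (hF x).eq_zero_of_orthogonal ?_ (hb2 ▸ key _) (hb3 ▸ key _) ?_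
      (surfaceDeriv_time (hd x) h0 v)
    · have h1 := lorentzForm_surfaceDeriv_add hfd (hd x) hperp v
      rwa [htan, zero_add] at h1
    · have h1 := lorentzForm_surfaceDeriv_add (hd x) (hd x) hnull v
      rw [lorentzForm_comm _ (h x)] at h1
      rw [hh x _ (he x)]
      linarith
  obtain ⟨p⟩ : Nonempty N := inferInstance
  refine ⟨h p, h0 p, hnull p, fun x => ?_⟩
  rw [mfderiv_eq_zero_imp_const hd hzero p x, lorentzForm_comm, hperp]

end Surfaces

/-! ### Local diffeomorphisms from injective differentials. -/

/-- The inverse function theorem: a smooth map between manifolds of the same dimension with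
injective differentials is a local diffeomorphism. -/
theorem ContMDiff.isLocalDiffeomorph_of_injective {E M M' : Type*} [NormedAddCommGroup E]
    [NormedSpace ℝ E] [FiniteDimensional ℝ E] [TopologicalSpace M] [ChartedSpace E M]
    [IsManifold 𝓘(ℝ, E) ∞ M] [TopologicalSpace M'] [ChartedSpace E M'] [IsManifold 𝓘(ℝ, E) ∞ M']
    {f : M → M'} (hf : ContMDiff 𝓘(ℝ, E) 𝓘(ℝ, E) ∞ f)
    (hinj : ∀ x, Function.Injective (mfderiv 𝓘(ℝ, E) 𝓘(ℝ, E) f x)) :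
    IsLocalDiffeomorph 𝓘(ℝ, E) 𝓘(ℝ, E) ∞ f := by
  have : CompleteSpace E := FiniteDimensional.complete ℝ E
  intro p
  let φ := chartAt E p
  let ψ := chartAt E (f p)
  let F : E → E := ψ ∘ f ∘ φ.symm
  let U : Set E := φ.target ∩ φ.symm ⁻¹' (f ⁻¹' ψ.source)
  have hU : IsOpen U := φ.isOpen_inter_preimage_symm (ψ.open_source.preimage hf.continuous)
  have hF (u) (hu : u ∈ U) : ContDiffAt ℝ ∞ F u := by
    have h1 : ContMDiffAt 𝓘(ℝ, E) 𝓘(ℝ, E) ∞ φ.symm u :=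
      (contMDiffOn_chart_symm (I := 𝓘(ℝ, E)) (n := ∞) (x := p)).contMDiffAt
        (φ.open_target.mem_nhds hu.1)
    have h2 : ContMDiffAt 𝓘(ℝ, E) 𝓘(ℝ, E) ∞ ψ (f (φ.symm u)) :=
      (contMDiffOn_chart (I := 𝓘(ℝ, E)) (n := ∞) (x := f p)).contMDiffAt
        (ψ.open_source.mem_nhds hu.2)
    exact (h2.comp u ((hf _).comp u h1)).contDiffAt
  have hF' (u) (hu : u ∈ U) : ∃ L : E ≃L[ℝ] E, HasFDerivAt F (L : E →L[ℝ] E) u := by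
    have hφ := (mdifferentiable_chart (I := 𝓘(ℝ, E)) p).symm
    have hψ := mdifferentiable_chart (I := 𝓘(ℝ, E)) (f p)
    have h1 := (hφ.mdifferentiableAt hu.1).hasMFDerivAt
    have h2 := (hψ.mdifferentiableAt hu.2).hasMFDerivAt
    have h3 := ((hf (φ.symm u)).mdifferentiableAt (by simp)).hasMFDerivAt
    let D : E →L[ℝ] E := (mfderiv 𝓘(ℝ, E) 𝓘(ℝ, E) ψ (f (φ.symm u))).comp
      ((mfderiv 𝓘(ℝ, E) 𝓘(ℝ, E) f (φ.symm u)).comp (mfderiv 𝓘(ℝ, E) 𝓘(ℝ, E) φ.symm u))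
    have h4 : HasFDerivAt F D u := (h2.comp u (h3.comp u h1)).hasFDerivAt
    have h5 := (hψ.mfderiv_injective hu.2).comp ((hinj _).comp (hφ.mfderiv_injective hu.1))
    let e : E ≃ₗ[ℝ] E := LinearEquiv.ofInjectiveEndo D.toLinearMap h5
    exact ⟨e.toContinuousLinearEquiv, h4⟩
  have hpU : φ p ∈ U := by
    refine ⟨mem_chart_target E p, ?_⟩
    change f (φ.symm (φ p)) ∈ ψ.source
    rw [φ.left_inv (mem_chart_source E p)]
    exact mem_chart_source E (f p)
  obtain ⟨L, hL⟩ := hF' _ hpU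
  -- Restricting to `U` keeps the derivative invertible at every point of the source, as smoothness
  -- of the inverse on the whole target requires.
  let G := ((hF _ hpU).toOpenPartialHomeomorph F hL (by simp)).restrOpen U hU
  have hGF (u : E) : G u = F u := rfl
  have hGU : G.source ⊆ U := fun u hu => hu.2
  have hpG : φ p ∈ G.source := ⟨ContDiffAt.mem_toOpenPartialHomeomorph_source _ hL (by simp), hpU⟩
  have hGs : ContMDiffOn 𝓘(ℝ, E) 𝓘(ℝ, E) ∞ G.symm G.target := by
    intro b hb
    have hb' := hGU (G.map_target hb)
    obtain ⟨L', hL'⟩ := hF' _ hb'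
    exact (G.contDiffAt_symm hb hL' (hF _ hb')).contMDiffAt.contMDiffWithinAt
  let Φ := (φ.trans G).trans ψ.symm
  have hΦ : Set.EqOn f Φ Φ.source := by
    intro x hx
    have hx1 : x ∈ φ.source := hx.1.1
    have hx2 : φ x ∈ U := hGU hx.1.2
    have hx3 : f (φ.symm (φ x)) ∈ ψ.source := hx2.2
    change f x = ψ.symm (ψ (f (φ.symm (φ x))))
    rw [ψ.left_inv hx3, φ.left_inv hx1]
  refine ⟨⟨Φ.toPartialEquiv, Φ.open_source, Φ.open_target,
    fun x hx => (hf x).contMDiffWithinAt.congr (fun z hz => (hΦ hz).symm) (hΦ hx).symm, ?_⟩,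
    ?_, hΦ⟩
  · have h1 : ContMDiffOn 𝓘(ℝ, E) 𝓘(ℝ, E) ∞ ψ Φ.target :=
      (contMDiffOn_chart (I := 𝓘(ℝ, E)) (n := ∞) (x := f p)).mono fun y hy => hy.1
    have h2 := hGs.comp h1 fun y hy => hy.2.1
    exact (contMDiffOn_chart_symm (I := 𝓘(ℝ, E)) (n := ∞) (x := p)).comp h2 fun y hy => hy.2.2
  · refine ⟨⟨mem_chart_source E p, hpG⟩, ?_⟩
    change ψ (f (φ.symm (φ p))) ∈ ψ.target
    exact ψ.map_source hpU.2

/-! ### Projection along the null direction to the sphere. -/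

/-- The projection of `ℝ⁵₁` onto its last three coordinates. -/
def spaceProj : R51 →L[ℝ] EuclideanSpace ℝ (Fin 3) :=
  (EuclideanSpace.equiv (Fin 3) ℝ).symm.toContinuousLinearMap.comp
    (ContinuousLinearMap.pi ![ContinuousLinearMap.proj 2, ContinuousLinearMap.proj 3,
      ContinuousLinearMap.proj 4])

theorem spaceProj_zero (u : R51) : spaceProj u 0 = u 2 := rfl
theorem spaceProj_one (u : R51) : spaceProj u 1 = u 3 := rfl
theorem spaceProj_two (u : R51) : spaceProj u 2 = u 4 := rfl

/-- On the hyperplane orthogonal to `(1, 1, 0, 0, 0)` the first two terms of the form cancel. -/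
theorem inner_spaceProj {u w : R51} (hu : u 0 = u 1) (hw : w 0 = w 1) :
    inner ℝ (spaceProj u) (spaceProj w) = lorentzForm u w := by
  rw [lorentzForm_apply, hu, hw, PiLp.inner_apply, Fin.sum_univ_three, spaceProj_zero,
    spaceProj_one, spaceProj_two, spaceProj_zero, spaceProj_one, spaceProj_two]
  simp
  ring

theorem lorentzForm_null (u : R51) : lorentzForm u ![1, 1, 0, 0, 0] = u 1 - u 0 := by
  rw [lorentzForm_apply]
  simp
  ring

section Surfaces

variable {N : Type*} [TopologicalSpace N] [ChartedSpace (EuclideanSpace ℝ (Fin 2)) N]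

theorem IsIsometricImmersion.exists_sphereMap [IsManifold (𝓡 2) ∞ N]
    [RiemannianBundle (fun x : N => TangentSpace (𝓡 2) x)] {f : N → R51}
    (hf : IsIsometricImmersion f) {n : R51} (hn0 : n 0 = 1) (hn : lorentzForm n n = 0)
    (hnf : ∀ x, lorentzForm n (f x) = 0) :
    ∃ A : R51 ≃ₗ[ℝ] R51, IsPseudosphereIsometry A ∧ ∃ (y : N → S2) (l : N → ℝ),
      ContMDiff (𝓡 2) (𝓡 2) ∞ y ∧ ContMDiff (𝓡 2) 𝓘(ℝ, ℝ) ∞ l ∧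
      (∀ x, f x = A ![l x, l x, (y x).1 0, (y x).1 1, (y x).1 2]) ∧
      ∀ (x : N) (v w : TangentSpace (𝓡 2) x), sphereMetric (y x)
        (mfderiv (𝓡 2) (𝓡 2) y x v) (mfderiv (𝓡 2) (𝓡 2) y x w) = inner ℝ v w := by
  have : Fact (Module.finrank ℝ (EuclideanSpace ℝ (Fin 3)) = 2 + 1) := ⟨by simp⟩
  set k : R51 := ![1, 1, 0, 0, 0] with hk
  let A := lorentzReflectionEquiv (n - k)
  have hA : IsPseudosphereIsometry A := lorentzForm_lorentzReflection _
  have hAA (x : R51) : A (A x) = x := lorentzReflection_involutive _ x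
  have hAn : A n = k := lorentzReflection_null hn (by rw [hk, lorentzForm_null]; simp)
    (by rw [hn0]; rfl)
  have hperp (u : R51) (hu : lorentzForm n u = 0) : A u 0 = A u 1 := by
    have h1 : lorentzForm (A u) k = 0 := by rw [← hAn, hA, lorentzForm_comm, hu]
    rw [hk, lorentzForm_null] at h1
    linarith
  -- The differential also takes values in `n^⊥`, so the projection preserves inner products of
  -- tangent vectors.
  have hdf (x : N) (v : TangentSpace (𝓡 2) x) : lorentzForm n (surfaceDeriv f x v) = 0 := by
    have h1 := lorentzForm_surfaceDeriv_add (x := x) (mdifferentiableAt_const (c := n))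
      ((hf.smooth x).mdifferentiableAt (by simp)) hnf v
    have h2 : surfaceDeriv (fun _ : N => n) x v = 0 := by
      rw [surfaceDeriv, mfderiv_const]; rfl
    rwa [h2, map_zero, LinearMap.zero_apply, zero_add] at h1
  let B : R51 →L[ℝ] R51 := A.toLinearMap.toContinuousLinearMap
  let Y : N → EuclideanSpace ℝ (Fin 3) := fun x => (spaceProj.comp B) (f x)
  have hY : ContMDiff (𝓡 2) 𝓘(ℝ, EuclideanSpace ℝ (Fin 3)) ∞ Y :=
    (spaceProj.comp B).contMDiff.comp hf.smooth
  have hYs (x) : Y x ∈ Metric.sphere (0 : EuclideanSpace ℝ (Fin 3)) 1 := by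
    rw [mem_sphere_zero_iff_norm]
    have h1 : inner ℝ (Y x) (Y x) = 1 :=
      (inner_spaceProj (hperp _ (hnf x)) (hperp _ (hnf x))).trans
        ((hA _ _).trans (hf.mem_pseudosphere x))
    rw [real_inner_self_eq_norm_sq] at h1
    nlinarith [norm_nonneg (Y x)]
  have hyc : ContMDiff (𝓡 2) (𝓡 2) ∞ (Set.codRestrict Y _ hYs : N → S2) :=
    hY.codRestrict_sphere hYs
  refine ⟨A, hA, Set.codRestrict Y _ hYs, fun x => A (f x) 0, hyc, ?_, ?_, ?_⟩
  · exact ((ContinuousLinearMap.proj (R := ℝ) (φ := fun _ : Fin 5 => ℝ) 0).comp B).contMDiff.comp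
      hf.smooth
  · intro x
    rw [← hAA (f x)]
    congr 1
    ext i
    fin_cases i
    · rfl
    · exact (hperp _ (hnf x)).symm
    all_goals rfl
  · intro x v w
    have hy := (hyc x).mdifferentiableAt (by simp)
    have hι := (contMDiff_coe_sphere (n := 2) (m := ∞) (E := EuclideanSpace ℝ (Fin 3))
      (Set.codRestrict Y _ hYs x)).mdifferentiableAt (by simp)
    have h1 := hι.hasMFDerivAt.comp x hy.hasMFDerivAt
    have h2 := (spaceProj.comp B).hasFDerivAt.hasMFDerivAt.comp x
      ((hf.smooth x).mdifferentiableAt (by simp)).hasMFDerivAt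
    have h3 := hasMFDerivAt_unique h1 h2
    have h4 (v : TangentSpace (𝓡 2) x) : mfderiv (𝓡 2) 𝓘(ℝ, EuclideanSpace ℝ (Fin 3))
        (Subtype.val : S2 → EuclideanSpace ℝ (Fin 3)) (Set.codRestrict Y _ hYs x)
        (mfderiv (𝓡 2) (𝓡 2) (Set.codRestrict Y _ hYs) x v) =
        spaceProj (A (surfaceDeriv f x v)) := congrArg (fun L => L v) h3
    have h5 := inner_spaceProj (hperp _ (hdf x v)) (hperp _ (hdf x w))
    rw [hA, hf.isometric, ← h4, ← h4] at h5
    exact h5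

end Surfaces

/-- The function `l ∘ Φ⁻¹` lives only on the target of `Φ`. Multiplying by a bump function supported
there makes it global, at the cost of shrinking the source to where the bump is 1. -/
theorem PartialDiffeomorph.exists_extension {M M' : Type*} [TopologicalSpace M]
    [ChartedSpace (EuclideanSpace ℝ (Fin 2)) M] [TopologicalSpace M'] [T2Space M']
    [ChartedSpace (EuclideanSpace ℝ (Fin 2)) M'] [IsManifold (𝓡 2) ∞ M']
    (Φ : PartialDiffeomorph (𝓡 2) (𝓡 2) M M' ∞) {p : M} (hp : p ∈ Φ.source) {l : M → ℝ}
    (hl : ContMDiff (𝓡 2) 𝓘(ℝ, ℝ) ∞ l) :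
    ∃ (φ : PartialDiffeomorph (𝓡 2) (𝓡 2) M M' ∞) (m : M' → ℝ), p ∈ φ.source ∧
      ContMDiff (𝓡 2) 𝓘(ℝ, ℝ) ∞ m ∧ φ.source ⊆ Φ.source ∧ ∀ x ∈ φ.source,
      φ x = Φ x ∧ m (φ x) = l x := by
  have hq := Φ.map_source hp
  obtain ⟨b, -, hb⟩ := (SmoothBumpFunction.nhds_basis_tsupport (I := 𝓡 2) (Φ p)).mem_iff.mp
    (Φ.open_target.mem_nhds hq)
  obtain ⟨W, hW, hWo, hpW⟩ := mem_nhds_iff.mp b.eventuallyEq_one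
  let Ψ := Φ.toOpenPartialHomeomorph.restrOpen _
    (Φ.toOpenPartialHomeomorph.isOpen_inter_preimage hWo)
  have hsub : Ψ.source ⊆ Φ.source := fun x hx => hx.1
  have hsub' : Ψ.target ⊆ Φ.target := fun x hx => hx.1
  refine ⟨⟨Ψ.toPartialEquiv, Ψ.open_source, Ψ.open_target, Φ.contMDiffOn_toFun.mono hsub,
    Φ.contMDiffOn_invFun.mono hsub'⟩, fun z => b z • l (Φ.symm z), ⟨hp, hp, hpW⟩, fun z => ?_, hsub,
    fun x hx => ⟨rfl, ?_⟩⟩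
  · by_cases hz : z ∈ tsupport b
    · have h1 := Φ.contMDiffOn_invFun.contMDiffAt (Φ.open_target.mem_nhds (hb hz))
      exact b.contMDiffAt.smul ((hl _).comp z h1)
    · have h1 : (fun z => b z • l (Φ.symm z)) =ᶠ[𝓝 z] fun _ => 0 := by
        filter_upwards [(isClosed_tsupport b).isOpen_compl.mem_nhds hz] with w hw
        rw [image_eq_zero_of_notMem_tsupport hw, zero_smul]
      exact contMDiffAt_const.congr_of_eventuallyEq h1
  · have h1 : b (Φ x) = 1 := hW hx.2.2
    change b (Φ x) • l (Φ.symm (Φ x)) = l x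
    rw [h1, one_smul]
    congr 1
    exact Φ.left_inv (hsub hx)

/-! ### Gluing sections over stereographic charts. -/

section Sections

variable {N : Type*} [TopologicalSpace N] [T2Space N] {y : N → S2}

theorem S2.chartAt_source (q : S2) :
    (chartAt (EuclideanSpace ℝ (Fin 2)) q).source = {-q}ᶜ := by
  have : Fact (Module.finrank ℝ (EuclideanSpace ℝ (Fin 3)) = 2 + 1) := ⟨by simp⟩
  exact stereographic'_source (-q)

theorem S2.chartAt_target (q : S2) :
    (chartAt (EuclideanSpace ℝ (Fin 2)) q).target = Set.univ := by
  have : Fact (Module.finrank ℝ (EuclideanSpace ℝ (Fin 3)) = 2 + 1) := ⟨by simp⟩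
  exact stereographic'_target (-q)

/-- The chart at `q` projects from `-q`, so the set is a plane, or a plane without one point. -/
theorem S2.isPreconnected_compl_pair (q r : S2) : IsPreconnected ({-q}ᶜ ∩ {-r}ᶜ : Set S2) := by
  let c := chartAt (EuclideanSpace ℝ (Fin 2)) q
  have hc : c.source = {-q}ᶜ := S2.chartAt_source q
  by_cases h : r = q
  · subst h
    rw [Set.inter_self, ← hc, ← c.symm_image_target_eq_source, S2.chartAt_target]
    exact isPreconnected_univ.image _ (c.continuousOn_symm.mono (by rw [S2.chartAt_target]))
  · have h1 : ({-q}ᶜ ∩ {-r}ᶜ : Set S2) = c.symm '' {c (-r)}ᶜ := by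
      ext z
      constructor
      · rintro ⟨hz, hz'⟩
        rw [← hc] at hz
        refine ⟨c z, fun h0 => hz' (c.injOn hz ?_ h0), c.left_inv hz⟩
        rw [hc]; simpa using h
      · rintro ⟨w, hw, rfl⟩
        have hw' : w ∈ c.target := by rw [S2.chartAt_target]; trivial
        refine ⟨hc ▸ c.map_target hw', fun h0 => hw ?_⟩
        rw [Set.mem_singleton_iff] at h0 ⊢
        rw [← h0, c.right_inv hw']
    rw [h1]
    refine IsPreconnected.image (isConnected_compl_singleton_of_one_lt_rank ?_ _).isPreconnected _
      (c.continuousOn_symm.mono (by rw [S2.chartAt_target]; exact Set.subset_univ _))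
    rw [rank_eq_card_basis (EuclideanSpace.basisFun (Fin 2) ℝ).toBasis]
    norm_num

/-- A local homeomorphism to the sphere that has a section through every point over the complement
of the antipode is a bijection. -/
theorem bijective_of_sections [ConnectedSpace N] (hy : IsLocalHomeomorph y)
    (H : ∀ p, ∃ s : S2 → N, ContinuousOn s {-(y p)}ᶜ ∧ s (y p) = p ∧
      ∀ z ∈ ({-(y p)}ᶜ : Set S2), y (s z) = z) : Function.Bijective y := by
  classical
  have hsep : IsSeparatedMap y := T2Space.isSeparatedMap y
  obtain ⟨p⟩ : Nonempty N := inferInstance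
  obtain ⟨s₁, hs₁, hp₁, hys₁⟩ := H p
  set q := y p
  let c := chartAt (EuclideanSpace ℝ (Fin 2)) q
  -- Any point `r` other than `±q` will do: the section based over `r` is defined at `-q`, the only
  -- point missed by `s₁`.
  obtain ⟨w, hw⟩ := exists_ne (c q)
  have hw' : w ∈ c.target := by rw [S2.chartAt_target]; trivial
  set r := c.symm w
  have hrq : r ≠ q := by
    intro h
    apply hw
    rw [← h, c.right_inv hw']
  have hr : r ∈ ({-q}ᶜ : Set S2) := S2.chartAt_source q ▸ c.map_target hw'
  obtain ⟨s₂, hs₂, hp₂, hys₂⟩ := H (s₁ r)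
  rw [hys₁ r hr] at hs₂ hp₂ hys₂
  have hself (z : S2) : z ∈ ({-z}ᶜ : Set S2) := ne_neg_of_mem_unit_sphere ℝ z
  have heq : Set.EqOn s₁ s₂ ({-q}ᶜ ∩ {-r}ᶜ) :=
    hsep.eqOn_of_comp_eqOn hy.isLocallyInjective (S2.isPreconnected_compl_pair q r)
      (hs₁.mono Set.inter_subset_left) (hs₂.mono Set.inter_subset_right)
      (fun z hz => (hys₁ z hz.1).trans (hys₂ z hz.2).symm) ⟨hr, hself r⟩ hp₂.symm
  let S : S2 → N := fun z => if z = -q then s₂ z else s₁ z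
  have hqr : -q ∈ ({-r}ᶜ : Set S2) := by
    rw [Set.mem_compl_singleton_iff, Ne, neg_inj]
    exact hrq.symm
  have hyS (z : S2) : y (S z) = z := by
    by_cases h : z = -q
    · simp only [S, if_pos h]
      exact hys₂ z (h ▸ hqr)
    · simp only [S, if_neg h]
      exact hys₁ z h
  have hS : Continuous S := by
    rw [continuous_iff_continuousAt]
    intro z
    by_cases h : z = -q
    · have h1 : S =ᶠ[𝓝 z] s₂ := by
        filter_upwards [isOpen_compl_singleton.mem_nhds (h ▸ hqr : z ∈ ({-r}ᶜ : Set S2))] with u hu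
        by_cases hu' : u = -q
        · simp only [S, if_pos hu']
        · simp only [S, if_neg hu']
          exact heq ⟨hu', hu⟩
      exact (hs₂.continuousAt (isOpen_compl_singleton.mem_nhds (h ▸ hqr))).congr h1.symm
    · have h1 : S =ᶠ[𝓝 z] s₁ := by
        filter_upwards [isOpen_compl_singleton.mem_nhds (h : z ∈ ({-q}ᶜ : Set S2))] with u hu
        exact if_neg hu
      exact (hs₁.continuousAt (isOpen_compl_singleton.mem_nhds h)).congr h1.symm
  -- Both `S ∘ y` and the identity lift `y` through `y` and agree at `S q`; lifts to a connected
  -- space's local homeomorphism are determined by one value.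
  have hid : S ∘ y = id := hsep.eq_of_comp_eq hy.isLocallyInjective (hS.comp hy.continuous)
    continuous_id (funext fun x => hyS (y x)) (S q) (by simp [hyS])
  exact ⟨Function.LeftInverse.injective (g := S) (congrFun hid), fun z => ⟨S z, hyS z⟩⟩

/-- If the images of the lines through the centre of stereographic charts lift, then there are
sections over the complement of the antipode. -/
theorem exists_section (hy : IsLocalHomeomorph y) (p : N)
    (H : ∀ w : EuclideanSpace ℝ (Fin 2), ∃ Γ : ℝ → N, ContinuousOn Γ (Set.Icc 0 1) ∧ Γ 0 = p ∧
      ∀ t ∈ Set.Icc (0 : ℝ) 1, y (Γ t) = (chartAt (EuclideanSpace ℝ (Fin 2)) (y p)).symm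
        (AffineMap.lineMap (chartAt (EuclideanSpace ℝ (Fin 2)) (y p) (y p)) w t)) :
    ∃ s : S2 → N, ContinuousOn s {-(y p)}ᶜ ∧ s (y p) = p ∧
      ∀ z ∈ ({-(y p)}ᶜ : Set S2), y (s z) = z := by
  have hsep : IsSeparatedMap y := T2Space.isSeparatedMap y
  set c := chartAt (EuclideanSpace ℝ (Fin 2)) (y p)
  have hc : Continuous c.symm := by
    rw [← continuousOn_univ, ← S2.chartAt_target (y p)]
    exact c.continuousOn_symm
  choose Γ hΓ hΓ0 hyΓ using H
  let F : C(unitInterval × EuclideanSpace ℝ (Fin 2), S2) :=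
    ⟨fun tw => c.symm (AffineMap.lineMap (c (y p)) tw.2 (tw.1 : ℝ)), by
      refine hc.comp ?_
      simp only [AffineMap.lineMap_apply_module]
      fun_prop⟩
  let g : unitInterval × EuclideanSpace ℝ (Fin 2) → N := fun tw => Γ tw.2 tw.1
  have hgc (w) : Continuous fun t : unitInterval => g (t, w) :=
    (hΓ w).comp_continuous continuous_subtype_val fun t => t.2
  have hg : Continuous g := by
    -- Continuity along each line and at the common starting point gives joint continuity in the
    -- endpoint.
    refine hy.continuous_lift hsep F (funext fun tw => hyΓ tw.2 tw.1 tw.1.2) ?_ hgc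
    have : (fun w => g (0, w)) = fun _ => p := funext hΓ0
    rw [this]
    exact continuous_const
  refine ⟨fun z => g (1, c z), ?_, ?_, ?_⟩
  · rw [← S2.chartAt_source]
    exact hg.comp_continuousOn (continuousOn_const.prodMk c.continuousOn)
  -- The line to the centre itself is constant, hence so is its lift.
  · have h1 := hsep.const_of_comp hy.isLocallyInjective (hgc (c (y p))) (fun a b => by
      simp only [g]
      rw [hyΓ _ _ a.2, hyΓ _ _ b.2, AffineMap.lineMap_same_apply, AffineMap.lineMap_same_apply]) 1 0
    exact h1.trans (hΓ0 _)
  · intro z hz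
    rw [← S2.chartAt_source] at hz
    simp only [g]
    rw [hyΓ _ _ (1 : unitInterval).2]
    simp [c.left_inv hz]

end Sections

/-! ### Path lifting by completeness. -/

/-- Curves lift to a complete space under a local homeomorphism if their lifts are Lipschitz. -/
theorem IsLocalHomeomorph.exists_lift_of_edist_le {E X : Type*} [EMetricSpace E] [CompleteSpace E]
    [TopologicalSpace X] [T2Space X] {y : E → X} (hy : IsLocalHomeomorph y) {γ : ℝ → X}
    (hγ : Continuous γ) {C : NNReal} {p : E} (hp : y p = γ 0)
    (hC : ∀ (a b : ℝ) (Γ : ℝ → E), 0 ≤ a → a ≤ b → b ≤ 1 → ContinuousOn Γ (Set.Icc a b) →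
      (∀ t ∈ Set.Icc a b, y (Γ t) = γ t) → edist (Γ a) (Γ b) ≤ C * ENNReal.ofReal (b - a)) :
    ∃ Γ : ℝ → E, ContinuousOn Γ (Set.Icc 0 1) ∧ Γ 0 = p ∧ ∀ t ∈ Set.Icc (0 : ℝ) 1,
      y (Γ t) = γ t := by
  have hsep : IsSeparatedMap y := T2Space.isSeparatedMap y
  let IsLift (T : ℝ) (Γ : ℝ → E) : Prop := ContinuousOn Γ (Set.Icc 0 T) ∧ Γ 0 = p ∧
    ∀ t ∈ Set.Icc 0 T, y (Γ t) = γ t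
  have hmono {S T : ℝ} {Γ : ℝ → E} (hST : S ≤ T) (h : IsLift T Γ) : IsLift S Γ :=
    ⟨h.1.mono (Set.Icc_subset_Icc_right hST), h.2.1,
      fun t ht => h.2.2 t (Set.Icc_subset_Icc_right hST ht)⟩
  have huniq {T : ℝ} {Γ Γ' : ℝ → E} (h : IsLift T Γ) (h' : IsLift T Γ') (hT : 0 ≤ T) :
      Γ T = Γ' T :=
    hsep.eqOn_of_comp_eqOn hy.isLocallyInjective isPreconnected_Icc h.1 h'.1
      (fun t ht => (h.2.2 t ht).trans (h'.2.2 t ht).symm) (Set.left_mem_Icc.mpr hT)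
      (h.2.1.trans h'.2.1.symm) (Set.right_mem_Icc.mpr hT)
  -- Continuity method: `S` is closed in the interval by completeness and can be prolonged to the
  -- right by a local inverse of `y`.
  let S : Set ℝ := {T | ∃ Γ, IsLift T Γ}
  suffices hS : Set.Icc 0 1 ⊆ S from hS (Set.right_mem_Icc.mpr zero_le_one)
  have h0 : (0 : ℝ) ∈ S := by
    refine ⟨fun _ => p, continuousOn_const, rfl, fun t ht => ?_⟩
    rw [Set.Icc_self, Set.mem_singleton_iff] at ht
    rw [ht, hp]
  refine IsClosed.Icc_subset_of_forall_exists_gt ?_ h0 ?_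
  · refine isClosed_of_closure_subset fun T hT => ?_
    have hT1 : T ∈ Set.Icc (0 : ℝ) 1 :=
      closure_minimal Set.inter_subset_right isClosed_Icc hT
    refine ⟨?_, hT1⟩
    by_contra hTS
    have hT0 : 0 < T := lt_of_le_of_ne hT1.1 fun h => hTS (h ▸ h0)
    have hex (t : ℝ) (ht : t < T) : ∃ Γ, IsLift t Γ := by
      obtain ⟨s, ⟨⟨Γ, hΓ⟩, -⟩, hs⟩ := Metric.mem_closure_iff.mp hT (T - t) (by linarith)
      rw [Real.dist_eq, abs_lt] at hs
      exact ⟨Γ, hmono (by linarith) hΓ⟩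
    have : Nonempty E := ⟨p⟩
    choose! Γ hΓ using hex
    -- By uniqueness the lifts on shorter intervals agree, so their endpoints form one lift on `[0,
    -- T)`. It is Lipschitz and hence has a limit at `T`.
    let G : ℝ → E := fun s => Γ s s
    have hG {s t : ℝ} (hs : 0 ≤ s) (hst : s ≤ t) (ht : t < T) : G s = Γ t s :=
      huniq (Γ := Γ s) (hΓ s (hst.trans_lt ht)) (hmono hst (hΓ t ht)) hs
    have hyG {s : ℝ} (hs : 0 ≤ s) (hsT : s < T) : y (G s) = γ s :=
      (hΓ s hsT).2.2 s (Set.right_mem_Icc.mpr hs)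
    have hlip {s t : ℝ} (hs : 0 ≤ s) (hst : s ≤ t) (ht : t < T) :
        edist (G s) (G t) ≤ C * ENNReal.ofReal (t - s) := by
      rw [hG hs hst ht]
      refine hC s t (Γ t) hs hst (ht.le.trans hT1.2) ((hΓ t ht).1.mono ?_)
        fun u hu => (hΓ t ht).2.2 u ⟨hs.trans hu.1, hu.2⟩
      exact Set.Icc_subset_Icc_left hs
    have hlip' {s t : ℝ} (hst : s ≤ t) : ENNReal.ofReal (t - s) = edist s t := by
      rw [edist_comm, edist_dist, Real.dist_eq, abs_of_nonneg (sub_nonneg.mpr hst)]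
    have hLG : LipschitzOnWith C G (Set.Ico 0 T) := by
      intro s hs t ht
      rcases le_total s t with h | h
      · rw [← hlip' h]; exact hlip hs.1 h ht.2
      · rw [edist_comm, edist_comm s, ← hlip' h]; exact hlip ht.1 h hs.2
    have hne : (𝓝[Set.Ico 0 T] T).NeBot := by
      rw [← mem_closure_iff_nhdsWithin_neBot, closure_Ico hT0.ne]
      exact Set.right_mem_Icc.mpr hT0.le
    have hcau : Cauchy (Filter.map G (𝓝[Set.Ico 0 T] T)) :=
      (cauchy_nhds.mono nhdsWithin_le_nhds).map_of_le hLG.uniformContinuousOn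
        (Filter.le_principal_iff.mpr self_mem_nhdsWithin)
    obtain ⟨z, hz⟩ := CompleteSpace.complete hcau
    have hz : Filter.Tendsto G (𝓝[Set.Ico 0 T] T) (𝓝 z) := hz
    have hyz : y z = γ T := by
      refine tendsto_nhds_unique ((hy.continuous.tendsto z).comp hz)
        ((hγ.continuousAt.tendsto.mono_left nhdsWithin_le_nhds).congr' ?_)
      filter_upwards [self_mem_nhdsWithin] with s hs using (hyG hs.1 hs.2).symm
    refine hTS ⟨Function.update G T z, ?_, ?_, fun t ht => ?_⟩
    · have h1 : Set.Icc 0 T \ {T} = Set.Ico 0 T := Set.Icc_sdiff_right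
      rw [continuousOn_update_iff, h1]
      exact ⟨hLG.continuousOn, fun _ => hz⟩
    · rw [Function.update_of_ne hT0.ne]
      exact (hΓ 0 hT0).2.1
    · rcases eq_or_ne t T with rfl | h
      · rw [Function.update_self, hyz]
      · rw [Function.update_of_ne h]
        exact hyG ht.1 (lt_of_le_of_ne ht.2 h)
  · rintro x ⟨⟨Γ, hΓ⟩, hx⟩ u hu
    obtain ⟨Φ, hΦx, hΦ⟩ := hy (Γ x)
    have hxx := Set.right_mem_Icc.mpr hx.1
    have htar : γ ⁻¹' Φ.target ∈ 𝓝 x := by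
      refine hγ.continuousAt.preimage_mem_nhds (Φ.open_target.mem_nhds ?_)
      rw [← hΓ.2.2 x hxx, hΦ]
      exact Φ.map_source hΦx
    obtain ⟨ε, hε, hball⟩ := Metric.mem_nhds_iff.mp htar
    let x' := min u (x + ε / 2)
    have hxx' : x < x' := lt_min hu (by linarith)
    refine ⟨x', ⟨fun s => if s ≤ x then Γ s else Φ.symm (γ s), ?_, ?_, fun t ht => ?_⟩, hxx',
      min_le_left _ _⟩
    · have hsub : ∀ s ∈ Set.Icc x x', γ s ∈ Φ.target := fun s hs => hball (by
        have := min_le_right u (x + ε / 2)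
        rw [Metric.mem_ball, Real.dist_eq, abs_lt]
        constructor <;> linarith [hs.1, hs.2])
      have hjoin : Γ x = Φ.symm (γ x) := by
        rw [← hΓ.2.2 x hxx, hΦ, Φ.left_inv hΦx]
      rw [← Set.Icc_union_Icc_eq_Icc hx.1 hxx'.le]
      refine ContinuousOn.union_of_isClosed (hΓ.1.congr fun s hs => if_pos hs.2) ?_
        isClosed_Icc isClosed_Icc
      refine ContinuousOn.congr (f := Φ.symm ∘ γ)
        (Φ.continuousOn_symm.comp hγ.continuousOn hsub) fun s hs => ?_
      rcases eq_or_lt_of_le hs.1 with rfl | h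
      · simp only [le_refl, if_true]
        exact hjoin
      · exact if_neg (not_le.mpr h)
    · simp only [hx.1, if_true]
      exact hΓ.2.1
    · dsimp only
      split_ifs with h
      · exact hΓ.2.2 t ⟨ht.1, h⟩
      · rw [hΦ]
        refine Φ.right_inv (hball ?_)
        have := min_le_right u (x + ε / 2)
        rw [Metric.mem_ball, Real.dist_eq, abs_lt]
        constructor <;> linarith [ht.2]

section Lifting

variable {N : Type*} [EMetricSpace N]
    [ChartedSpace (EuclideanSpace ℝ (Fin 2)) N]
    [RiemannianBundle (fun x : N => TangentSpace (𝓡 2) x)]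
    [IsRiemannianManifold (𝓡 2) N] {y : N → S2}

/-- Lifts of a curve in the sphere under a local isometry are not longer than the curve. -/
theorem edist_lift_le (hy : IsLocalDiffeomorph (𝓡 2) (𝓡 2) ∞ y)
    (hiso : ∀ (x : N) (v w : TangentSpace (𝓡 2) x), sphereMetric (y x)
      (mfderiv (𝓡 2) (𝓡 2) y x v) (mfderiv (𝓡 2) (𝓡 2) y x w) = inner ℝ v w)
    {γ : ℝ → S2} (hγ : ContMDiff 𝓘(ℝ, ℝ) (𝓡 2) ∞ γ) {C : NNReal} {a b : ℝ} (hab : a ≤ b)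
    (hC : ∀ t ∈ Set.Icc a b, ‖deriv (fun t => (γ t : EuclideanSpace ℝ (Fin 3))) t‖ ≤ C)
    {Γ : ℝ → N} (hΓ : ContinuousOn Γ (Set.Icc a b)) (hyΓ : ∀ t ∈ Set.Icc a b, y (Γ t) = γ t) :
    edist (Γ a) (Γ b) ≤ C * ENNReal.ofReal (b - a) := by
  -- A continuous lift is locally `Φ⁻¹ ∘ γ`, hence regular enough to have a length.
  have hΓs : ContMDiffOn 𝓘(ℝ, ℝ) (𝓡 2) 1 Γ (Set.Icc a b) := by
    intro t ht
    obtain ⟨Φ, hΦt, hΦ⟩ := hy (Γ t)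
    have h1 : ContMDiffAt (𝓡 2) (𝓡 2) ∞ Φ.symm (γ t) :=
      Φ.contMDiffOn_invFun.contMDiffAt (Φ.open_target.mem_nhds (by
        rw [← hyΓ t ht, hΦ hΦt]; exact Φ.map_source hΦt))
    have h2 : ContMDiffWithinAt 𝓘(ℝ, ℝ) (𝓡 2) 1 (Φ.symm ∘ γ) (Set.Icc a b) t :=
      ((h1.comp t (hγ t)).of_le (by simp)).contMDiffWithinAt
    have key (s) (hs : s ∈ Set.Icc a b) (hs' : Γ s ∈ Φ.source) : Γ s = (Φ.symm ∘ γ) s := by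
      rw [Function.comp_apply, ← hyΓ s hs, hΦ hs']
      exact (Φ.left_inv hs').symm
    refine h2.congr_of_eventuallyEq ?_ (key t ht hΦt)
    filter_upwards [self_mem_nhdsWithin,
      (hΓ t ht).preimage_mem_nhdsWithin (Φ.open_source.mem_nhds hΦt)] with s hs hs'
      using key s hs hs'
  have hspeed (t) (ht : t ∈ Set.Ioo a b) : ‖mfderiv 𝓘(ℝ, ℝ) (𝓡 2) Γ t 1‖ₑ ≤ C := by
    have hmem : Set.Icc a b ∈ 𝓝 t := Icc_mem_nhds ht.1 ht.2
    have h1 := (hΓs.contMDiffAt hmem).mdifferentiableAt (by simp)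
    have h2 := (hy.contMDiff (Γ t)).mdifferentiableAt (by simp)
    have h3 := (hγ t).mdifferentiableAt (by simp)
    have : Fact (Module.finrank ℝ (EuclideanSpace ℝ (Fin 3)) = 2 + 1) := ⟨by simp⟩
    have hι := (contMDiff_coe_sphere (n := 2) (m := ∞) (E := EuclideanSpace ℝ (Fin 3))
      (y (Γ t))).mdifferentiableAt (by simp)
    have h4 := hι.hasMFDerivAt.comp t (h2.hasMFDerivAt.comp t h1.hasMFDerivAt)
    have h5 : (fun t => (γ t : EuclideanSpace ℝ (Fin 3))) =ᶠ[𝓝 t]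
        Subtype.val ∘ y ∘ Γ := by
      filter_upwards [hmem] with s hs
      rw [Function.comp_apply, Function.comp_apply, hyΓ s hs]
    let D : ℝ →L[ℝ] EuclideanSpace ℝ (Fin 3) :=
      (mfderiv (𝓡 2) 𝓘(ℝ, EuclideanSpace ℝ (Fin 3)) (Subtype.val : S2 → _) (y (Γ t))).comp
        ((mfderiv (𝓡 2) (𝓡 2) y (Γ t)).comp (mfderiv 𝓘(ℝ, ℝ) (𝓡 2) Γ t))
    have h6' : HasFDerivAt (fun t => (γ t : EuclideanSpace ℝ (Fin 3))) D t :=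
      (h4.congr_of_eventuallyEq h5).hasFDerivAt
    have h6 := h6'.hasDerivAt.deriv
    have h7 := hiso (Γ t) (mfderiv 𝓘(ℝ, ℝ) (𝓡 2) Γ t 1) (mfderiv 𝓘(ℝ, ℝ) (𝓡 2) Γ t 1)
    have h8 : sphereMetric (y (Γ t))
        (mfderiv (𝓡 2) (𝓡 2) y (Γ t) (mfderiv 𝓘(ℝ, ℝ) (𝓡 2) Γ t 1))
        (mfderiv (𝓡 2) (𝓡 2) y (Γ t) (mfderiv 𝓘(ℝ, ℝ) (𝓡 2) Γ t 1)) =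
        ‖deriv (fun t => (γ t : EuclideanSpace ℝ (Fin 3))) t‖ ^ 2 := by
      rw [h6, ← real_inner_self_eq_norm_sq]
      rfl
    rw [h8, real_inner_self_eq_norm_sq] at h7
    have h9 : ‖mfderiv 𝓘(ℝ, ℝ) (𝓡 2) Γ t 1‖ ≤ C := by
      have := hC t ⟨ht.1.le, ht.2.le⟩
      rw [← abs_of_nonneg (norm_nonneg (mfderiv 𝓘(ℝ, ℝ) (𝓡 2) Γ t 1)),
        ← (sq_eq_sq_iff_abs_eq_abs _ _).mp h7]
      rwa [abs_of_nonneg (norm_nonneg _)]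
    rw [enorm_le_coe]
    exact h9
  rw [IsRiemannianManifold.out (I := 𝓡 2)]
  refine (riemannianEDist_le_pathELength hΓs rfl rfl hab).trans ?_
  rw [pathELength_eq_lintegral_mfderiv_Ioo]
  refine (MeasureTheory.setLIntegral_mono measurable_const hspeed).trans ?_
  rw [MeasureTheory.setLIntegral_const, Real.volume_Ioo]

/-- A local isometry of a complete connected surface to the sphere is bijective. -/
theorem bijective_of_isometric [ConnectedSpace N] [CompleteSpace N]
    (hy : IsLocalDiffeomorph (𝓡 2) (𝓡 2) ∞ y)
    (hiso : ∀ (x : N) (v w : TangentSpace (𝓡 2) x), sphereMetric (y x)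
      (mfderiv (𝓡 2) (𝓡 2) y x v) (mfderiv (𝓡 2) (𝓡 2) y x w) = inner ℝ v w) :
    Function.Bijective y := by
  have : Fact (Module.finrank ℝ (EuclideanSpace ℝ (Fin 3)) = 2 + 1) := ⟨by simp⟩
  have hyh := hy.isLocalHomeomorph
  refine bijective_of_sections hyh fun p => exists_section hyh p fun w => ?_
  set c := chartAt (EuclideanSpace ℝ (Fin 2)) (y p)
  let γ : ℝ → S2 := fun t => c.symm (AffineMap.lineMap (c (y p)) w t)
  have hγ : ContMDiff 𝓘(ℝ, ℝ) (𝓡 2) ∞ γ := by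
    have h1 := contMDiffOn_chart_symm (I := 𝓡 2) (n := ∞) (x := y p)
    rw [S2.chartAt_target, contMDiffOn_univ] at h1
    have h2 : ContDiff ℝ ∞ fun t : ℝ => AffineMap.lineMap (c (y p)) w t := by
      simp only [AffineMap.lineMap_apply_module]
      fun_prop
    exact h1.comp h2.contMDiff
  have hγ' : ContDiff ℝ ∞ fun t => (γ t : EuclideanSpace ℝ (Fin 3)) :=
    ((contMDiff_coe_sphere (n := 2) (m := ∞) (E := EuclideanSpace ℝ (Fin 3))).comp hγ).contDiff
  obtain ⟨C, hC⟩ := (isCompact_Icc (a := (0 : ℝ)) (b := 1)).exists_bound_of_continuousOn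
    (hγ'.continuous_deriv (by simp)).continuousOn
  refine hyh.exists_lift_of_edist_le hγ.continuous (C := C.toNNReal) (p := p) ?_
    fun a b Γ ha hab hb hΓ hyΓ => edist_lift_le hy hiso hγ hab (fun t ht => ?_) hΓ hyΓ
  · change y p = c.symm (AffineMap.lineMap (c (y p)) w (0 : ℝ))
    rw [AffineMap.lineMap_apply_zero]
    exact (c.left_inv (mem_chart_source _ _)).symm
  · exact (hC t ⟨ha.trans ht.1, ht.2.trans hb⟩).trans (Real.le_coe_toNNReal C)

end Lifting

end

/-! ### Both claims from the local isometry to the sphere. -/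

theorem mainTheorem7 {N : Type*} [EMetricSpace N] [ConnectedSpace N]
    [ChartedSpace (EuclideanSpace ℝ (Fin 2)) N] [IsManifold (𝓡 2) ∞ N]
    [RiemannianBundle (fun x : N => TangentSpace (𝓡 2) x)]
    [IsContMDiffRiemannianBundle (𝓡 2) ∞ (EuclideanSpace ℝ (Fin 2))
      (fun x : N => TangentSpace (𝓡 2) x)]
    [IsRiemannianManifold (𝓡 2) N]
    (o : SurfaceOrientation N) (f : N → R51)
    (hf : IsIsometricImmersion f) (hiso : IsPlusIsotropic o f) :
    (CompleteSpace N → IsIsometricToSphere N) ∧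
    ∃ A : R51 ≃ₗ[ℝ] R51, IsPseudosphereIsometry A ∧
      ∀ p : N, ∃ (φ : PartialDiffeomorph (𝓡 2) (𝓡 2) N S2 ∞) (l : S2 → ℝ),
        p ∈ φ.source ∧ ContMDiff (𝓡 2) 𝓘(ℝ, ℝ) ∞ l ∧
        ∀ x ∈ φ.source, f x = A (modelSurface l (φ x)) := by
  obtain ⟨n, hn0, hn, hnf⟩ := hiso.exists_null hf
  obtain ⟨A, hA, y, l, hy, hl, hfy, hmetric⟩ := hf.exists_sphereMap hn0 hn hnf
  have hinj (x : N) : Function.Injective (mfderiv (𝓡 2) (𝓡 2) y x) := by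
    rw [injective_iff_map_eq_zero]
    intro v hv
    have h := hmetric x v v
    rw [hv] at h
    rw [← inner_self_eq_zero (𝕜 := ℝ), ← h]
    simp only [sphereMetric, map_zero]
    exact inner_zero_left (𝕜 := ℝ) (0 : EuclideanSpace ℝ (Fin 3))
  have hloc := hy.isLocalDiffeomorph_of_injective hinj
  refine ⟨fun _ => ?_, A, hA, fun p => ?_⟩
  · exact ⟨hloc.diffeomorphOfBijective (bijective_of_isometric hloc hmetric), hmetric⟩
  · obtain ⟨Φ, hp, hΦ⟩ := hloc p
    obtain ⟨φ, m, hpφ, hm, hsub, hφ⟩ := Φ.exists_extension hp hl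
    refine ⟨φ, m, hpφ, hm, fun x hx => ?_⟩
    obtain ⟨h1, h2⟩ := hφ x hx
    rw [hfy, modelSurface, h2, h1, ← hΦ (hsub hx)]
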